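/- Let $N\ge 1$, let $\Omega\subset\mathbb{R}^N$ be a bounded open set with boundary of class $C^2$, let $d(x)=\operatorname{dist}(x,\partial\Omega)$ and $D=\max_{\overline\Omega}d$. Let $\mathbf b\in\mathbb{R}^N$ be a constant vector, let $f:(0,\infty)\to\mathbb{R}$ (a function of time only) belong to $L^\infty(0,T)$ for every $T>0$, and let $$z_0\in\mathbb K_1=\{v\in H_0^1(\Omega):|\nabla v|\le 1\text{ a.e. in }\Omega\},\qquad \mathbb K_\diamond=\{v\in H_0^1(\Omega):-d\le v\le d\text{ a.e. in }\Omega\}.$$ For $\mathbb K=\mathbb K_1$ or $\mathbb K=\mathbb K_\diamond$, a solution of the variational inequality with convex set $\mathbb K$ is a function $z$ on $[0,\infty)\times\overline\Omega$ which, for every $T>0$ and with $Q_T=\Omega\times(0,T)$, belongs to $L^\infty(0,T;W^{1,\infty}_0(\Omega))\cap H^1(0,T;L^2(\Omega))\cap C(\overline{Q_T})$ and satisfies $z(0)=z_0$ and, for a.e. $t\in(0,T)$, $z(t)\in\mathbb K$ and $$\int_\Omega \partial_t z(t)(v-z(t))+\int_\Omega \mathbf b\cdot\nabla z(t)\,(v-z(t))\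 \ge\ \int_\Omega f(t)(v-z(t))\qquad\forall v\in\mathbb K .$$ Theorem 4.3. Assume in addition that (i) for every $t>0$, $\mathbf b\cdot\nabla z_0\le f(t)$ a.e. in $\{x\in\Omega: z_0(x)>-d(x)\}$; (ii) $f$ is nondecreasing and nonnegative on $(0,\infty)$; (iii) $\liminf_{t\to\infty}f(t)>|\mathbf b|+2D$, where the value $+\infty$ of the lower limit is allowed. Then there exists $T_*\in[0,\infty)$ such that every solution $z$ of the variational inequality with convex set $\mathbb K_1$, and likewise every solution $z$ with convex set $\mathbb K_\diamond$, satisfies $$z(x,t)=d(x)\qquad\text{for all }t\ge T_*\text{ and all }x\in\overline\Omega .$$ -/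

import Mathlib

open MeasureTheory Set Filter Topology
open scoped ContDiff

noncomputable section

namespace Sandpile

/-- `ℝ^N` with its Euclidean norm. -/
abbrev Space (N : ℕ) : Type := EuclideanSpace ℝ (Fin N)

/-- The boundary of `Ω` is of class `C²`: near each boundary point, `Ω` is the negativity set of a
`C²` function whose differential does not vanish at that point. -/
def HasC2Boundary {N : ℕ} (Ω : Set (Space N)) : Prop :=
  ∀ x₀ ∈ frontier Ω, ∃ U ∈ 𝓝 x₀, ∃ ρ : Space N → ℝ,
    ContDiff ℝ 2 ρ ∧ fderiv ℝ ρ x₀ ≠ 0 ∧ ∀ x ∈ U, x ∈ Ω ↔ ρ x < 0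

/-- The distance to the boundary of `Ω`. -/
def bdist {N : ℕ} (Ω : Set (Space N)) (x : Space N) : ℝ :=
  Metric.infDist x (frontier Ω)

/-- The number `max_{x ∈ closure Ω} d(x, ∂Ω)`. -/
def maxBdist {N : ℕ} (Ω : Set (Space N)) : ℝ :=
  sSup (bdist Ω '' closure Ω)

/-- `v` belongs to `H¹₀(Ω)` and its weak gradient is `G` (both up to null sets): the pair `(v, G)`
is the limit in `L²(Ω)` of `(φₙ, ∇φₙ)` with test functions `φₙ ∈ C_c^∞(Ω)`. -/
def HasH10Gradient {N : ℕ} (Ω : Set (Space N)) (v : Space N → ℝ) (G : Space N → Space N) : Prop :=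
  MemLp v 2 (volume.restrict Ω) ∧ MemLp G 2 (volume.restrict Ω) ∧
  ∃ φ : ℕ → Space N → ℝ,
    (∀ n, ContDiff ℝ ∞ (φ n) ∧ HasCompactSupport (φ n) ∧ tsupport (φ n) ⊆ Ω) ∧
    Tendsto (fun n => eLpNorm (fun x => φ n x - v x) 2 (volume.restrict Ω)) atTop (𝓝 0) ∧
    Tendsto (fun n => eLpNorm (fun x => gradient (φ n) x - G x) 2 (volume.restrict Ω))
      atTop (𝓝 0)

/-- The convex set `{v ∈ H¹₀(Ω) : |∇v| ≤ 1 a.e. in Ω}`. -/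
def gradientSet {N : ℕ} (Ω : Set (Space N)) : Set (Space N → ℝ) :=
  {v | ∃ G : Space N → Space N, HasH10Gradient Ω v G ∧ ∀ᵐ x ∂volume.restrict Ω, ‖G x‖ ≤ 1}

/-- The convex set `{v ∈ H¹₀(Ω) : -d ≤ v ≤ d a.e. in Ω}`. -/
def obstacleSet {N : ℕ} (Ω : Set (Space N)) : Set (Space N → ℝ) :=
  {v | (∃ G : Space N → Space N, HasH10Gradient Ω v G) ∧
    ∀ᵐ x ∂volume.restrict Ω, -bdist Ω x ≤ v x ∧ v x ≤ bdist Ω x}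

/-- The space-time cylinder `Q_T`, with time as the first coordinate. -/
def cylinder {N : ℕ} (Ω : Set (Space N)) (T : ℝ) : Set (ℝ × Space N) :=
  Ioo 0 T ×ˢ Ω

/-- `p` is the weak (distributional) time derivative of `z` in `Q_T`. -/
def HasWeakTimeDeriv {N : ℕ} (Ω : Set (Space N)) (T : ℝ) (z p : ℝ → Space N → ℝ) : Prop :=
  ∀ φ : ℝ × Space N → ℝ, ContDiff ℝ ∞ φ → HasCompactSupport φ → tsupport φ ⊆ cylinder Ω T →
    ∫ q in cylinder Ω T, z q.1 q.2 * fderiv ℝ φ q (1, 0) =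
      -∫ q in cylinder Ω T, p q.1 q.2 * φ q

/-- `z` solves on `(0, T)` the evolution variational inequality
`∫_Ω ∂ₜz (v - z) + ∫_Ω b·∇z (v - z) ≥ ∫_Ω f (v - z)` for all `v ∈ K`, for a.e. `t`, with
`z(t) ∈ K` and `z(0) = z₀`, in the class
`L^∞(0,T; W₀^{1,∞}(Ω)) ∩ H¹(0,T; L²(Ω)) ∩ C(closure Q_T)`.
Here `p` and `G` are the weak derivatives `∂ₜz` and `∇z`; `z` itself is bounded on `Q_T` because it
is continuous on the compact closure. -/
def SolvesOn {N : ℕ} (Ω : Set (Space N)) (b : Space N) (f : ℝ → ℝ) (z₀ : Space N → ℝ)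
    (K : Set (Space N → ℝ)) (T : ℝ) (z : ℝ → Space N → ℝ) : Prop :=
  ContinuousOn (fun q : ℝ × Space N => z q.1 q.2) (Icc 0 T ×ˢ closure Ω) ∧
  (∀ᵐ x ∂volume.restrict Ω, z 0 x = z₀ x) ∧
  ∃ (p : ℝ → Space N → ℝ) (G : ℝ → Space N → Space N),
    MemLp (fun q : ℝ × Space N => p q.1 q.2) 2 (volume.restrict (cylinder Ω T)) ∧
    HasWeakTimeDeriv Ω T z p ∧
    MemLp (fun q : ℝ × Space N => G q.1 q.2) ⊤ (volume.restrict (cylinder Ω T)) ∧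
    (∀ᵐ t ∂volume.restrict (Ioo 0 T), HasH10Gradient Ω (z t) (G t)) ∧
    (∀ᵐ t ∂volume.restrict (Ioo 0 T), z t ∈ K ∧ ∀ v ∈ K,
      ∫ x in Ω, f t * (v x - z t x) ≤
        (∫ x in Ω, p t x * (v x - z t x)) + ∫ x in Ω, inner ℝ b (G t x) * (v x - z t x))

/-- `z` is a solution global in time: it is a solution on `(0, T)` for each `T > 0`. -/
def Solves {N : ℕ} (Ω : Set (Space N)) (b : Space N) (f : ℝ → ℝ) (z₀ : Space N → ℝ)
    (K : Set (Space N → ℝ)) (z : ℝ → Space N → ℝ) : Prop :=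
  ∀ T : ℝ, 0 < T → SolvesOn Ω b f z₀ K T z

end Sandpile

end

/-! The graph of `z` is pushed up by a moving barrier. Once `f ≥ ‖b‖ + δ` on `[s, ∞)` with `δ > 0`,
consider `d - c(τ)` with `c(τ) = 2D - δ(τ - s)`. At time `s` the barrier lies below `-d`, hence
below `z`; it rises at speed `δ` and coincides with `d` at `t = s + 2D/δ`. If `z` never falls below
it, then `z(t) ≥ d`, and the constraint gives `z(t) ≤ d`.

That `z` stays above is an energy estimate for the gap `Q = (d - z - c)⁺`. The function `max (d - c)
z = z + Q` is admissible in either convex set (`mem_convexSet_properties`), so the variational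
inequality gives `∫ f Q ≤ ∫ ∂ₜz Q + ∫ b·∇z Q`. Where `Q > 0` one has `∇z = ∇d - ∇Q`; since `b` is
constant, `∫ b·∇Q Q = 0`, and since `d` is 1-Lipschitz, the transport term is at most `‖b‖ ∫ Q`
(`HasH10Gradient.integral_inner_mul_gap_le`). Hence `∫ Q (δ - ∂ₜz) ≤ 0`, which says that `∫ Q²` does
not increase from its initial value zero (`SolvesOn.eq_bdist`).

The remaining work is regularity. A continuous `H¹₀` function with bounded gradient has a Lipschitz
zero extension (`HasH10Gradient.lipschitzWith`; this is where the boundary regularity enters), and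
Lipschitz functions vanishing off `Ω` lie in `H¹₀` (`exists_hasH10Gradient_of_lipschitz`); together
they make the test function admissible. Almost every path `τ ↦ z τ x` is a primitive of the weak
time derivative (`HasWeakTimeDeriv.ae_forall_eq_add_integral`), which justifies the chain rule for
`Q²`. -/

namespace Sandpile

open scoped NNReal ENNReal Convolution

variable {N : ℕ} {Ω : Set (Space N)}

/-! ### Geometry of the boundary and the distance function. -/

/-- Every boundary point of a set with `C²` boundary is a limit of exterior points. -/
lemma HasC2Boundary.frontier_subset_closure (h : HasC2Boundary Ω) (hΩ : IsOpen Ω) :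
    frontier Ω ⊆ closure (closure Ω)ᶜ := by
  intro x₀ hx₀
  obtain ⟨U, hU, ρ, hρ, hdρ, hUρ⟩ := h x₀ hx₀
  have hx₀Ω : x₀ ∉ Ω := by
    rw [hΩ.frontier_eq] at hx₀
    exact hx₀.2
  have hρ0 : 0 ≤ ρ x₀ := not_lt.1 fun hlt => hx₀Ω ((hUρ x₀ (mem_of_mem_nhds hU)).2 hlt)
  have hnot : ¬ IsLocalMax ρ x₀ := fun hmax => hdρ hmax.fderiv_eq_zero
  have hfreq : ∃ᶠ x in 𝓝 x₀, ρ x₀ < ρ x := by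
    simpa [IsLocalMax, IsMaxFilter, Filter.not_eventually] using hnot
  rw [mem_closure_iff_frequently]
  -- Points `x` with `ρ x > ρ x₀ ≥ 0` accumulate at `x₀`; near such an `x` the function `ρ` stays
  -- positive, which excludes points of `Ω`, so `x` is exterior.
  refine (hfreq.and_eventually (eventually_eventually_nhds.2 hU)).mono fun x hx hxΩ => ?_
  have hpos : ∀ᶠ y in 𝓝 x, 0 < ρ y :=
    hρ.continuous.continuousAt.eventually (lt_mem_nhds (hρ0.trans_lt hx.1))
  obtain ⟨y, hyΩ, hy, hyU⟩ :=
    ((mem_closure_iff_frequently.1 hxΩ).and_eventually (hpos.and hx.2)).exists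
  exact (((hUρ y hyU).1 hyΩ).trans hy).false

lemma compl_nonempty_of_isBounded (hN : 1 ≤ N) (hb : Bornology.IsBounded Ω) : Ωᶜ.Nonempty := by
  have : NeZero N := ⟨by omega⟩
  have : Nonempty (Fin N) := ⟨0⟩
  rw [nonempty_compl]
  rintro rfl
  exact NormedSpace.unbounded_univ ℝ (Space N) hb

/-- A nearest point of `Ωᶜ` to a point of `Ω` lies on the frontier. The distance to `Ωᶜ` is the
convenient form of `d`: it is 1-Lipschitz on the whole space and vanishes off `Ω`. -/
lemma bdist_eq_infDist_compl (hΩ : IsOpen Ω) (hc : Ωᶜ.Nonempty) {x : Space N}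
    (hx : x ∈ closure Ω) : bdist Ω x = Metric.infDist x Ωᶜ := by
  have hsub : frontier Ω ⊆ Ωᶜ := by
    rw [hΩ.frontier_eq]
    exact fun y hy => hy.2
  by_cases hxΩ : x ∈ Ω
  · obtain ⟨y, hy, hxy⟩ := exists_mem_frontier_infDist_compl_eq_dist hxΩ
      (fun h => by simp [h] at hc)
    refine le_antisymm ?_ (Metric.infDist_le_infDist_of_subset hsub ⟨y, hy⟩)
    rw [hxy]
    exact Metric.infDist_le_dist_of_mem hy
  · have hf : x ∈ frontier Ω := by
      rw [hΩ.frontier_eq]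
      exact ⟨hx, hxΩ⟩
    rw [bdist, Metric.infDist_zero_of_mem hf, Metric.infDist_zero_of_mem (hsub hf)]

lemma bdist_le_maxBdist (hb : Bornology.IsBounded Ω) {x : Space N} (hx : x ∈ closure Ω) :
    bdist Ω x ≤ maxBdist Ω :=
  le_csSup ((hb.isCompact_closure.image (Metric.continuous_infDist_pt _)).bddAbove)
    (mem_image_of_mem _ hx)

lemma maxBdist_nonneg : 0 ≤ maxBdist Ω :=
  Real.sSup_nonneg (by rintro _ ⟨x, -, rfl⟩; exact Metric.infDist_nonneg)

/-! ### From bounded weak gradients to Lipschitz zero extensions. -/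

lemma gradient_eq_zero_of_notMem_tsupport {φ : Space N → ℝ} {x : Space N} (hx : x ∉ tsupport φ) :
    gradient φ x = 0 := by
  have : fderiv ℝ φ x = 0 := by
    have := support_fderiv_subset ℝ (f := φ)
    by_contra h
    exact hx (this h)
  simp [gradient, this]

lemma norm_gradient (φ : Space N → ℝ) (x : Space N) : ‖gradient φ x‖ = ‖fderiv ℝ φ x‖ := by
  simp [gradient]

lemma continuous_gradient {φ : Space N → ℝ} (hφ : ContDiff ℝ ∞ φ) : Continuous (gradient φ) :=
  (InnerProductSpace.toDual ℝ (Space N)).symm.continuous.comp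
    (hφ.continuous_fderiv (by simp))

/-- Increments of a smooth function exceed `M ‖h‖` at most as much, in the mean, as its gradient
exceeds `M`. -/
lemma lintegral_increment_excess_le {φ : Space N → ℝ} (hφ : ContDiff ℝ ∞ φ) (M : ℝ)
    (h : Space N) :
    ∫⁻ x, ENNReal.ofReal (|φ (x + h) - φ x| - M * ‖h‖) ≤
      ENNReal.ofReal ‖h‖ * ∫⁻ x, ENNReal.ofReal (‖gradient φ x‖ - M) := by
  have hcont := continuous_gradient hφ
  have hpt : ∀ x, ENNReal.ofReal (|φ (x + h) - φ x| - M * ‖h‖) ≤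
      ENNReal.ofReal ‖h‖ * ∫⁻ s in Ioc (0 : ℝ) 1,
        ENNReal.ofReal (‖gradient φ (x + s • h)‖ - M) := by
    intro x
    have hderiv : ∀ s ∈ uIcc (0 : ℝ) 1,
        HasDerivAt (fun s : ℝ => φ (x + s • h)) (fderiv ℝ φ (x + s • h) h) s := by
      intro s _
      have h1 : HasDerivAt (fun s : ℝ => x + s • h) h s := by
        simpa using ((hasDerivAt_id s).smul_const h).const_add x
      exact ((hφ.differentiable (by simp)) (x + s • h)).hasFDerivAt.comp_hasDerivAt s h1
    have hcd : Continuous fun s : ℝ => fderiv ℝ φ (x + s • h) h :=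
      ((hφ.continuous_fderiv (by simp)).comp (by fun_prop)).clm_apply continuous_const
    have hftc := intervalIntegral.integral_eq_sub_of_hasDerivAt hderiv
      (hcd.intervalIntegrable _ _)
    simp only [one_smul, zero_smul, add_zero] at hftc
    have hcg : Continuous fun s : ℝ => ‖gradient φ (x + s • h)‖ :=
      (hcont.comp (by fun_prop)).norm
    have hb1 : |φ (x + h) - φ x| - M * ‖h‖ ≤
        ‖h‖ * ∫ s in (0 : ℝ)..1, max (‖gradient φ (x + s • h)‖ - M) 0 := by
      have h1 : |φ (x + h) - φ x| ≤
          ∫ s in (0 : ℝ)..1, ‖h‖ * (max (‖gradient φ (x + s • h)‖ - M) 0 + M) := by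
        rw [← hftc, ← Real.norm_eq_abs]
        refine (intervalIntegral.norm_integral_le_integral_norm zero_le_one).trans ?_
        refine intervalIntegral.integral_mono_on zero_le_one (hcd.norm.intervalIntegrable _ _)
          ((by fun_prop : Continuous _).intervalIntegrable _ _) fun s _ => ?_
        refine (ContinuousLinearMap.le_opNorm _ _).trans ?_
        rw [norm_gradient, mul_comm]
        gcongr
        linarith [le_max_left (‖fderiv ℝ φ (x + s • h)‖ - M) 0]
      rw [intervalIntegral.integral_const_mul, intervalIntegral.integral_add
        ((by fun_prop : Continuous _).intervalIntegrable _ _)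
        (continuous_const.intervalIntegrable _ _)] at h1
      simp only [intervalIntegral.integral_const, sub_zero, one_smul] at h1
      linarith
    refine (ENNReal.ofReal_le_ofReal hb1).trans ?_
    rw [ENNReal.ofReal_mul (norm_nonneg _), intervalIntegral.integral_of_le zero_le_one,
      ofReal_integral_eq_lintegral_ofReal]
    · refine mul_le_mul_right (lintegral_mono fun s => le_of_eq ?_) _
      simp [ENNReal.ofReal_max]
    · exact ((by fun_prop : Continuous _).intervalIntegrable (μ := volume) 0 1).1
    · exact Eventually.of_forall fun s => le_max_right _ _
  -- After integrating in `x`, Tonelli and translation invariance remove the shift by `s • h`.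
  calc ∫⁻ x, ENNReal.ofReal (|φ (x + h) - φ x| - M * ‖h‖)
      ≤ ∫⁻ x, ENNReal.ofReal ‖h‖ * ∫⁻ s in Ioc (0 : ℝ) 1,
          ENNReal.ofReal (‖gradient φ (x + s • h)‖ - M) := lintegral_mono hpt
    _ = ENNReal.ofReal ‖h‖ * ∫⁻ x, ∫⁻ s in Ioc (0 : ℝ) 1,
          ENNReal.ofReal (‖gradient φ (x + s • h)‖ - M) := by
        rw [lintegral_const_mul' _ _ ENNReal.ofReal_ne_top]
    _ = ENNReal.ofReal ‖h‖ * ∫⁻ s in Ioc (0 : ℝ) 1, ∫⁻ x,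
          ENNReal.ofReal (‖gradient φ (x + s • h)‖ - M) := by
        rw [lintegral_lintegral_swap]
        refine Measurable.aemeasurable (Continuous.measurable ?_)
        exact ENNReal.continuous_ofReal.comp
          (((hcont.comp (by fun_prop)).norm).sub continuous_const)
    _ = ENNReal.ofReal ‖h‖ * ∫⁻ s in Ioc (0 : ℝ) 1, ∫⁻ x,
          ENNReal.ofReal (‖gradient φ x‖ - M) := by
        congr 1
        refine lintegral_congr fun s => ?_
        exact lintegral_add_right_eq_self
          (fun x => ENNReal.ofReal (‖gradient φ x‖ - M)) (s • h)
    _ = ENNReal.ofReal ‖h‖ * ∫⁻ x, ENNReal.ofReal (‖gradient φ x‖ - M) := by simp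

lemma tendsto_lintegral_enorm_of_eLpNorm_two {E : Type*} [NormedAddCommGroup E]
    (hb : Bornology.IsBounded Ω) {F : ℕ → Space N → E}
    (hF : ∀ n, AEStronglyMeasurable (F n) (volume.restrict Ω))
    (h : Tendsto (fun n => eLpNorm (F n) 2 (volume.restrict Ω)) atTop (𝓝 0)) :
    Tendsto (fun n => ∫⁻ x in Ω, ‖F n x‖ₑ) atTop (𝓝 0) := by
  have hfin : (volume.restrict Ω) univ ^ (1 / (1 : ℝ≥0∞).toReal - 1 / (2 : ℝ≥0∞).toReal) ≠ ⊤ := by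
    refine ENNReal.rpow_ne_top_of_nonneg (by norm_num) ?_
    rw [Measure.restrict_apply_univ]
    exact hb.measure_lt_top.ne
  have h2 := ENNReal.Tendsto.mul_const h (Or.inr hfin)
  rw [zero_mul] at h2
  refine tendsto_of_tendsto_of_tendsto_of_le_of_le tendsto_const_nhds h2 (fun _ => bot_le) ?_
  intro n
  have := eLpNorm_le_eLpNorm_mul_rpow_measure_univ (μ := volume.restrict Ω) (p := 1) (q := 2)
    (by norm_num) (hF n)
  rwa [eLpNorm_one_eq_lintegral_enorm] at this

/-- Test functions approximating `v` in `H¹₀(Ω)`, together with the convergence in `L¹`. -/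
lemma HasH10Gradient.exists_approx (hb : Bornology.IsBounded Ω) {v : Space N → ℝ}
    {G : Space N → Space N} (h : HasH10Gradient Ω v G) :
    ∃ φ : ℕ → Space N → ℝ,
      (∀ n, ContDiff ℝ ∞ (φ n) ∧ HasCompactSupport (φ n) ∧ tsupport (φ n) ⊆ Ω) ∧
      Tendsto (fun n => ∫⁻ x in Ω, ‖φ n x - v x‖ₑ) atTop (𝓝 0) ∧
      Tendsto (fun n => ∫⁻ x in Ω, ‖gradient (φ n) x - G x‖ₑ) atTop (𝓝 0) := by
  obtain ⟨hv, hG, φ, hφ, h1, h2⟩ := h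
  refine ⟨φ, hφ, tendsto_lintegral_enorm_of_eLpNorm_two hb (fun n => ?_) h1,
    tendsto_lintegral_enorm_of_eLpNorm_two hb (fun n => ?_) h2⟩
  · exact (hφ n).1.continuous.aestronglyMeasurable.sub hv.1
  · exact (continuous_gradient (hφ n).1).aestronglyMeasurable.sub hG.1

/-- The zero extension of an `H¹₀` function with gradient bounded by `M` has increments bounded by
`M`, almost everywhere. -/
lemma HasH10Gradient.ae_increment_le (hΩ : IsOpen Ω) (hb : Bornology.IsBounded Ω)
    {v : Space N → ℝ} {G : Space N → Space N} (h : HasH10Gradient Ω v G) {M : ℝ} (hM : 0 ≤ M)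
    (hGM : ∀ᵐ x ∂volume.restrict Ω, ‖G x‖ ≤ M) (e : Space N) :
    ∀ᵐ x, |Ω.indicator v (x + e) - Ω.indicator v x| ≤ M * ‖e‖ := by
  obtain ⟨φ, hφ, hφv, hφG⟩ := h.exists_approx hb
  set u := Ω.indicator v with hu
  have hφ0 : ∀ n, ∀ x ∉ Ω, φ n x = 0 := fun n x hx =>
    image_eq_zero_of_notMem_tsupport fun hx' => hx ((hφ n).2.2 hx')
  have hum : AEMeasurable u :=
    (aemeasurable_indicator_iff hΩ.measurableSet).2 h.1.1.aemeasurable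
  have hume : AEMeasurable fun x => u (x + e) :=
    hum.comp_quasiMeasurePreserving
      (measurePreserving_add_right volume e).quasiMeasurePreserving
  have hdiff : ∀ n, ∫⁻ x, ‖φ n x - u x‖ₑ = ∫⁻ x in Ω, ‖φ n x - v x‖ₑ := by
    intro n
    rw [← lintegral_indicator hΩ.measurableSet]
    refine lintegral_congr fun x => ?_
    by_cases hx : x ∈ Ω
    · simp [hu, hx]
    · simp [hu, hx, hφ0 n x hx]
  -- As `‖G‖ ≤ M`, the excess of `‖∇φₙ‖` over `M` is at most `‖∇φₙ - G‖`, so it tends to zero in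
  -- `L¹` although no pointwise bound on `∇φₙ` is available. Off `Ω` the truncation in
  -- `ENNReal.ofReal` makes it zero.
  have hgrad : ∀ n, ∫⁻ x, ENNReal.ofReal (‖gradient (φ n) x‖ - M) ≤
      ∫⁻ x in Ω, ‖gradient (φ n) x - G x‖ₑ := by
    intro n
    have h1 : ∫⁻ x, ENNReal.ofReal (‖gradient (φ n) x‖ - M) =
        ∫⁻ x in Ω, ENNReal.ofReal (‖gradient (φ n) x‖ - M) := by
      rw [← lintegral_indicator hΩ.measurableSet]
      refine lintegral_congr fun x => ?_
      by_cases hx : x ∈ Ω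
      · simp [hx]
      · have := gradient_eq_zero_of_notMem_tsupport fun hx' => hx ((hφ n).2.2 hx')
        simp [hx, this, hM]
    rw [h1]
    refine lintegral_mono_ae (hGM.mono fun x hx => ?_)
    rw [← ofReal_norm]
    refine ENNReal.ofReal_le_ofReal ?_
    linarith [norm_sub_norm_le (gradient (φ n) x) (G x)]
  have hbound : ∀ n, ∫⁻ x, ENNReal.ofReal (|u (x + e) - u x| - M * ‖e‖) ≤
      (∫⁻ x in Ω, ‖φ n x - v x‖ₑ) + (∫⁻ x in Ω, ‖φ n x - v x‖ₑ) +
        ENNReal.ofReal ‖e‖ * ∫⁻ x in Ω, ‖gradient (φ n) x - G x‖ₑ := by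
    intro n
    have hm1 : AEMeasurable fun x => ‖φ n x - u x‖ₑ :=
      ((hφ n).1.continuous.measurable.aemeasurable.sub hum).enorm
    have hm2 : AEMeasurable fun x => ‖φ n (x + e) - u (x + e)‖ₑ :=
      (((hφ n).1.continuous.comp (continuous_add_const e)).measurable.aemeasurable.sub hume).enorm
    calc ∫⁻ x, ENNReal.ofReal (|u (x + e) - u x| - M * ‖e‖)
        ≤ ∫⁻ x, (‖φ n (x + e) - u (x + e)‖ₑ + ‖φ n x - u x‖ₑ +
            ENNReal.ofReal (|φ n (x + e) - φ n x| - M * ‖e‖)) := by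
          refine lintegral_mono fun x => ?_
          rw [← ofReal_norm, ← ofReal_norm,
            ← ENNReal.ofReal_add (norm_nonneg _) (norm_nonneg _)]
          refine (ENNReal.ofReal_le_ofReal ?_).trans ENNReal.ofReal_add_le
          simp only [Real.norm_eq_abs]
          have e1 : u (x + e) - u x = -(φ n (x + e) - u (x + e)) + (φ n x - u x) +
            (φ n (x + e) - φ n x) := by ring
          have e2 := abs_add_three (-(φ n (x + e) - u (x + e))) (φ n x - u x)
            (φ n (x + e) - φ n x)
          rw [abs_neg] at e2
          rw [e1]
          linarith
      _ = (∫⁻ x, ‖φ n (x + e) - u (x + e)‖ₑ) + (∫⁻ x, ‖φ n x - u x‖ₑ) +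
            ∫⁻ x, ENNReal.ofReal (|φ n (x + e) - φ n x| - M * ‖e‖) := by
          have hm3 : AEMeasurable fun x => ‖φ n (x + e) - u (x + e)‖ₑ + ‖φ n x - u x‖ₑ :=
            hm2.add hm1
          rw [lintegral_add_left' hm3, lintegral_add_left' hm2]
      _ ≤ _ := by
          rw [lintegral_add_right_eq_self (fun x => ‖φ n x - u x‖ₑ) e, hdiff]
          exact add_le_add_right ((lintegral_increment_excess_le (hφ n).1 M e).trans
            (mul_le_mul_right (hgrad n) _)) _
  have hlim : Tendsto (fun n => (∫⁻ x in Ω, ‖φ n x - v x‖ₑ) + (∫⁻ x in Ω, ‖φ n x - v x‖ₑ) +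
        ENNReal.ofReal ‖e‖ * ∫⁻ x in Ω, ‖gradient (φ n) x - G x‖ₑ) atTop (𝓝 0) := by
    simpa using (hφv.add hφv).add
      (ENNReal.Tendsto.const_mul hφG (Or.inr (ENNReal.ofReal_ne_top (r := ‖e‖))))
  have hzero : ∫⁻ x, ENNReal.ofReal (|u (x + e) - u x| - M * ‖e‖) = 0 :=
    le_antisymm (ge_of_tendsto' hlim hbound) zero_le
  rw [lintegral_eq_zero_iff'] at hzero
  · filter_upwards [hzero] with x hx
    simpa using hx
  · exact (((hume.sub hum).abs).sub aemeasurable_const).ennreal_ofReal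

/-- A continuous `H¹₀` function with gradient bounded by `M` has an `M`-Lipschitz zero
extension. -/
lemma HasH10Gradient.lipschitzWith (hΩ : IsOpen Ω) (hb : Bornology.IsBounded Ω)
    (hf : frontier Ω ⊆ closure (closure Ω)ᶜ)
    {v : Space N → ℝ} {G : Space N → Space N} (h : HasH10Gradient Ω v G)
    (hv : ContinuousOn v Ω) {M : ℝ≥0}
    (hGM : ∀ᵐ x ∂volume.restrict Ω, ‖G x‖ ≤ M) : LipschitzWith M (Ω.indicator v) := by
  set u := Ω.indicator v with hu
  -- Only the frontier is left out: on `W` the zero extension is continuous, so the almost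
  -- everywhere increment bound holds there at every pair of points.
  set W := Ω ∪ (closure Ω)ᶜ with hW
  have hcont : ∀ x ∈ W, ContinuousAt u x := by
    rintro x (hx | hx)
    · refine (hv.continuousAt (hΩ.mem_nhds hx)).congr ?_
      filter_upwards [hΩ.mem_nhds hx] with y hy
      simp [hu, hy]
    · refine (continuousAt_const (y := (0 : ℝ))).congr ?_
      filter_upwards [isClosed_closure.isOpen_compl.mem_nhds hx] with y hy
      have : y ∉ Ω := fun hy' => hy (subset_closure hy')
      simp [hu, this]
  have h1 : ∀ x ∈ W, ∀ y ∈ W, |u x - u y| ≤ M * dist x y := by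
    intro x hx y hy
    have hae := h.ae_increment_le hΩ hb M.2 hGM (y - x)
    have hfr : ∃ᶠ x' in 𝓝 x, |u (x' + (y - x)) - u x'| ≤ M * ‖y - x‖ :=
      mem_closure_iff_frequently.1 ((Measure.dense_of_ae hae) x)
    have hcy : ContinuousAt (fun x' => u (x' + (y - x))) x := by
      refine ContinuousAt.comp (g := u) ?_ (by fun_prop)
      simpa using hcont y hy
    have ht : Tendsto (fun x' => |u (x' + (y - x)) - u x'|) (𝓝 x)
        (𝓝 |u (x + (y - x)) - u x|) := (hcy.sub (hcont x hx)).abs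
    have := le_of_tendsto_of_frequently ht hfr
    rw [add_sub_cancel] at this
    rwa [abs_sub_comm, dist_comm, dist_eq_norm]
  -- Continuity at frontier points is not known yet. But `u` vanishes both there and at the exterior
  -- points accumulating there, so the estimate passes to the limit in the position alone.
  have hext : ∀ x ∉ W, u x = 0 ∧ x ∈ closure (closure Ω)ᶜ := by
    intro x hx
    simp only [hW, mem_union, mem_compl_iff, not_or, not_not] at hx
    refine ⟨by simp [hu, hx.1], hf ?_⟩
    rw [hΩ.frontier_eq]
    exact ⟨hx.2, hx.1⟩
  have hu0 : ∀ x ∈ (closure Ω)ᶜ, u x = 0 := fun x hx => by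
    have : x ∉ Ω := fun hy' => hx (subset_closure hy')
    simp [hu, this]
  have h2 : ∀ x, ∀ y ∈ W, |u x - u y| ≤ M * dist x y := by
    intro x y hy
    by_cases hx : x ∈ W
    · exact h1 x hx y hy
    obtain ⟨hx0, hxc⟩ := hext x hx
    have hcl : IsClosed {x' | |0 - u y| ≤ M * dist x' y} :=
      isClosed_le continuous_const (by fun_prop)
    rw [hx0]
    refine closure_minimal (fun x' hx' => ?_) hcl hxc
    have := h1 x' (Or.inr hx') y hy
    rwa [hu0 x' hx'] at this
  refine LipschitzWith.of_dist_le_mul fun x y => ?_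
  rw [Real.dist_eq]
  by_cases hy : y ∈ W
  · exact h2 x y hy
  obtain ⟨hy0, hyc⟩ := hext y hy
  have hcl : IsClosed {y' | |u x - 0| ≤ M * dist x y'} :=
    isClosed_le continuous_const (by fun_prop)
  rw [hy0]
  refine closure_minimal (fun y' hy' => ?_) hcl hyc
  have := h2 x y' (Or.inr hy')
  rwa [hu0 y' hy'] at this

/-! ### Lipschitz functions vanishing off `Ω` belong to `H¹₀`. -/

lemma tendsto_eLpNorm_two_of_bounded {α E : Type*} [MeasurableSpace α] {μ : Measure α}
    [IsFiniteMeasure μ] [NormedAddCommGroup E] {F : ℕ → α → E} {B : ℝ}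
    (hm : ∀ n, AEStronglyMeasurable (F n) μ) (hB : ∀ n, ∀ᵐ x ∂μ, ‖F n x‖ ≤ B)
    (h : ∀ᵐ x ∂μ, Tendsto (fun n => F n x) atTop (𝓝 0)) :
    Tendsto (fun n => eLpNorm (F n) 2 μ) atTop (𝓝 0) := by
  have h1 : Tendsto (fun n => ∫⁻ x, ‖F n x‖ₑ ^ (2 : ℝ) ∂μ) atTop (𝓝 (∫⁻ _, 0 ∂μ)) := by
    refine tendsto_lintegral_of_dominated_convergence' (fun _ => ENNReal.ofReal B ^ (2 : ℝ))
      (fun n => (hm n).enorm.pow_const _) (fun n => ?_) ?_ ?_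
    · filter_upwards [hB n] with x hx
      refine ENNReal.rpow_le_rpow ?_ (by norm_num)
      rw [← ofReal_norm]
      exact ENNReal.ofReal_le_ofReal hx
    · rw [lintegral_const]
      exact ENNReal.mul_ne_top (ENNReal.rpow_ne_top_of_nonneg (by norm_num) ENNReal.ofReal_ne_top)
        (measure_ne_top _ _)
    · filter_upwards [h] with x hx
      have := (ENNReal.continuous_rpow_const (y := 2)).tendsto 0 |>.comp
        (by simpa using hx.enorm : Tendsto (fun n => ‖F n x‖ₑ) atTop (𝓝 0))
      simpa [Function.comp_def] using this
  rw [lintegral_zero] at h1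
  have h2 := (ENNReal.continuous_rpow_const (y := 1 / 2)).tendsto 0 |>.comp h1
  refine Tendsto.congr (fun n => ?_) (by simpa [Function.comp_def] using h2)
  rw [eLpNorm_eq_lintegral_rpow_enorm_toReal (by norm_num) (by norm_num)]
  simp

lemma norm_gradient_sub (φ ψ : Space N → ℝ) (x : Space N) :
    ‖gradient φ x - gradient ψ x‖ = ‖fderiv ℝ φ x - fderiv ℝ ψ x‖ := by
  rw [gradient, gradient, ← map_sub, LinearIsometryEquiv.norm_map]

lemma measurable_gradient (u : Space N → ℝ) : Measurable (gradient u) :=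
  (InnerProductSpace.toDual ℝ (Space N)).symm.continuous.measurable.comp (measurable_fderiv ℝ u)

/-- The derivative of a mollified Lipschitz function is the mollified derivative. -/
lemma hasFDerivAt_convolution_of_lipschitz {v : Space N → ℝ} {C : ℝ≥0} (hv : LipschitzWith C v)
    (φ : ContDiffBump (0 : Space N)) (x : Space N) :
    HasFDerivAt (φ.normed volume ⋆[ContinuousLinearMap.lsmul ℝ ℝ, volume] v)
      ((φ.normed volume ⋆[ContinuousLinearMap.lsmul ℝ ℝ, volume] (fderiv ℝ v)) x) x := by
  have hφi : Integrable (φ.normed volume) := φ.integrable_normed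
  have hφc : Continuous (φ.normed volume) := φ.continuous_normed
  refine (hasFDerivAt_integral_of_dominated_loc_of_lip' (μ := volume) (𝕜 := ℝ)
    (F := fun x t => φ.normed volume t • v (x - t))
    (F' := fun t => φ.normed volume t • fderiv ℝ v (x - t))
    (bound := fun t => C * φ.normed volume t) univ_mem ?_ ?_ ?_ ?_ ?_ ?_).2
  · intro y _
    exact (hφc.smul (hv.continuous.comp (by fun_prop))).aestronglyMeasurable
  · refine Continuous.integrable_of_hasCompactSupport
      (hφc.smul (hv.continuous.comp (by fun_prop))) ?_
    exact φ.hasCompactSupport_normed.smul_right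
  · refine hφc.aestronglyMeasurable.smul ?_
    exact ((measurable_fderiv ℝ v).comp (by fun_prop)).aestronglyMeasurable
  · refine Eventually.of_forall fun t y _ => ?_
    rw [← smul_sub, norm_smul, Real.norm_eq_abs, abs_of_nonneg (φ.nonneg_normed t)]
    have := hv.norm_sub_le (y - t) (x - t)
    rw [sub_sub_sub_cancel_right] at this
    nlinarith [φ.nonneg_normed (μ := volume) t]
  · exact hφi.const_mul _
  · have hae := (Measure.measurePreserving_sub_left volume x).quasiMeasurePreserving.ae
      (hv.ae_differentiableAt (μ := volume))
    filter_upwards [hae] with t ht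
    have h1 : HasFDerivAt (fun y => v (y - t)) (fderiv ℝ v (x - t)) x := by
      simpa using! ht.hasFDerivAt.comp x ((hasFDerivAt_id x).sub_const t)
    exact h1.const_smul (φ.normed volume t)

lemma norm_convolution_normed_le {E : Type*} [NormedAddCommGroup E] [NormedSpace ℝ E]
    {g : Space N → E} {B : ℝ} (hg : ∀ x, ‖g x‖ ≤ B) (φ : ContDiffBump (0 : Space N))
    (x : Space N) :
    ‖(φ.normed volume ⋆[ContinuousLinearMap.lsmul ℝ ℝ, volume] g) x‖ ≤ B := by
  rw [convolution_def]
  have hint : ∫ t, φ.normed volume t * B = B := by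
    rw [integral_mul_const, φ.integral_normed, one_mul]
  rw [← hint]
  refine norm_integral_le_of_norm_le (φ.integrable_normed.mul_const B)
    (Eventually.of_forall fun t => ?_)
  rw [ContinuousLinearMap.lsmul_apply, norm_smul, Real.norm_eq_abs,
    abs_of_nonneg (φ.nonneg_normed t)]
  exact mul_le_mul_of_nonneg_left (hg _) (φ.nonneg_normed t)

/-- A Lipschitz function with compact support in `Ω` is approximated by mollification. -/
lemma exists_testFunction_near (hΩ : IsOpen Ω) (hb : Bornology.IsBounded Ω) {v : Space N → ℝ}
    {C : ℝ≥0} (hv : LipschitzWith C v) (hvc : HasCompactSupport v) (hvΩ : tsupport v ⊆ Ω)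
    {ε : ℝ≥0∞} (hε : 0 < ε) :
    ∃ φ : Space N → ℝ, (ContDiff ℝ ∞ φ ∧ HasCompactSupport φ ∧ tsupport φ ⊆ Ω) ∧
      eLpNorm (fun x => φ x - v x) 2 (volume.restrict Ω) < ε ∧
      eLpNorm (fun x => gradient φ x - gradient v x) 2 (volume.restrict Ω) < ε := by
  have : IsFiniteMeasure (volume.restrict Ω) := ⟨by
    rw [Measure.restrict_apply_univ]; exact hb.measure_lt_top⟩
  -- Mollification at radius at most `δ` keeps the support inside `Ω`.
  obtain ⟨δ, hδ, hδΩ⟩ := hvc.isCompact.exists_cthickening_subset_open hΩ hvΩ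
  let bump : ℕ → ContDiffBump (0 : Space N) := fun n =>
    { rIn := δ / (n + 1) / 2
      rOut := δ / (n + 1)
      rIn_pos := by positivity
      rIn_lt_rOut := half_lt_self (by positivity) }
  let ψ : ℕ → Space N → ℝ := fun n =>
    (bump n).normed volume ⋆[ContinuousLinearMap.lsmul ℝ ℝ, volume] v
  have hr : Tendsto (fun n => (bump n).rOut) atTop (𝓝 0) := by
    have := tendsto_one_div_add_atTop_nhds_zero_nat (𝕜 := ℝ).const_mul δ
    simpa [bump, div_eq_mul_inv] using this
  -- The derivative of `v` is merely bounded and measurable, so its mollifications converge only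
  -- almost everywhere, by Lebesgue differentiation; this needs comparable inner and outer radii.
  have hK : ∀ᶠ n in atTop, (bump n).rOut ≤ 2 * (bump n).rIn :=
    Eventually.of_forall fun n => by simp only [bump]; linarith
  have hsmooth : ∀ n, ContDiff ℝ ∞ (ψ n) := fun n =>
    (bump n).hasCompactSupport_normed.contDiff_convolution_left _ (bump n).contDiff_normed
      hv.continuous.locallyIntegrable
  have hsupp : ∀ n, tsupport (ψ n) ⊆ Metric.cthickening δ (tsupport v) := by
    intro n
    refine closure_minimal (fun x hx => ?_) Metric.isClosed_cthickening
    obtain ⟨y, hy, w, hw, rfl⟩ := support_convolution_subset _ hx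
    rw [(bump n).support_normed_eq, mem_ball_zero_iff] at hy
    refine Metric.mem_cthickening_of_dist_le _ w _ _ (subset_tsupport _ hw) ?_
    rw [dist_eq_norm, add_sub_cancel_right]
    refine hy.le.trans (div_le_self hδ.le ?_)
    simp
  obtain ⟨B, hB⟩ := hvc.exists_bound_of_continuous hv.continuous
  have hderiv : ∀ n x, fderiv ℝ (ψ n) x =
      ((bump n).normed volume ⋆[ContinuousLinearMap.lsmul ℝ ℝ, volume] (fderiv ℝ v)) x :=
    fun n x => (hasFDerivAt_convolution_of_lipschitz hv (bump n) x).fderiv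
  have hfb : ∀ x, ‖fderiv ℝ v x‖ ≤ C := fun x => norm_fderiv_le_of_lipschitz ℝ hv
  have hfl : LocallyIntegrable (fderiv ℝ v) volume := by
    intro x
    refine ⟨Metric.ball x 1, Metric.ball_mem_nhds x one_pos, ?_⟩
    exact Measure.integrableOn_of_bounded (M := C) Metric.isBounded_ball.measure_lt_top.ne
      (measurable_fderiv ℝ v).aestronglyMeasurable (Eventually.of_forall hfb)
  have h1 : Tendsto (fun n => eLpNorm (fun x => ψ n x - v x) 2 (volume.restrict Ω)) atTop
      (𝓝 0) := by
    refine tendsto_eLpNorm_two_of_bounded (B := B + B) (fun n =>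
      ((hsmooth n).continuous.sub hv.continuous).aestronglyMeasurable)
      (fun n => Eventually.of_forall fun x => ?_) (ae_restrict_of_ae ?_)
    · exact (norm_sub_le _ _).trans (add_le_add (norm_convolution_normed_le hB _ _) (hB x))
    · filter_upwards [ContDiffBump.ae_convolution_tendsto_right_of_locallyIntegrable
        (μ := volume) hr hK hv.continuous.locallyIntegrable] with x hx
      simpa using hx.sub_const (v x)
  have h2 : Tendsto (fun n => eLpNorm (fun x => gradient (ψ n) x - gradient v x) 2
      (volume.restrict Ω)) atTop (𝓝 0) := by
    refine tendsto_eLpNorm_two_of_bounded (B := C + C) (fun n =>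
      ((measurable_gradient _).sub (measurable_gradient _)).aestronglyMeasurable)
      (fun n => Eventually.of_forall fun x => ?_) (ae_restrict_of_ae ?_)
    · rw [norm_gradient_sub, hderiv]
      exact (norm_sub_le _ _).trans (add_le_add (norm_convolution_normed_le hfb _ _) (hfb x))
    · filter_upwards [ContDiffBump.ae_convolution_tendsto_right_of_locallyIntegrable
        (μ := volume) hr hK hfl] with x hx
      rw [tendsto_zero_iff_norm_tendsto_zero]
      simp only [norm_gradient_sub, hderiv]
      simpa using (hx.sub_const (fderiv ℝ v x)).norm
  obtain ⟨n, hn1, hn2⟩ := ((h1.eventually (gt_mem_nhds hε)).and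
    (h2.eventually (gt_mem_nhds hε))).exists
  exact ⟨ψ n, ⟨hsmooth n, HasCompactSupport.of_support_subset_isCompact hvc.isCompact.cthickening
    ((subset_tsupport _).trans (hsupp n)), (hsupp n).trans hδΩ⟩, hn1, hn2⟩

/-- The function `s ↦ s - ε` on `[ε, ∞)`, `s ↦ s + ε` on `(-∞, -ε]`, and zero in between. -/
def shrink (ε s : ℝ) : ℝ := max (s - ε) 0 + min (s + ε) 0

lemma shrink_eq_zero {ε s : ℝ} (h : |s| ≤ ε) : shrink ε s = 0 := by
  obtain ⟨h1, h2⟩ := abs_le.1 h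
  rw [shrink, max_eq_right (by linarith), min_eq_right (by linarith), add_zero]

lemma lipschitzWith_shrink {ε : ℝ} (hε : 0 ≤ ε) : LipschitzWith 1 (shrink ε) := by
  refine LipschitzWith.of_le_add_mul 1 fun s t => ?_
  rw [Real.dist_eq, NNReal.coe_one, one_mul]
  simp only [shrink, max_def, min_def, abs_eq_max_neg]
  split_ifs <;> linarith

lemma abs_shrink_sub_le {ε : ℝ} (hε : 0 ≤ ε) (s : ℝ) : |shrink ε s - s| ≤ ε := by
  rw [abs_le]
  simp only [shrink, max_def, min_def]
  constructor <;> split_ifs <;> linarith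

/-- A Lipschitz function vanishing outside `Ω` belongs to `H¹₀(Ω)`, with gradient bounded by its
Lipschitz constant. -/
lemma exists_hasH10Gradient_of_lipschitz (hΩ : IsOpen Ω) (hb : Bornology.IsBounded Ω)
    {u : Space N → ℝ} {C : ℝ≥0} (hu : LipschitzWith C u) (hu0 : ∀ x ∉ Ω, u x = 0) :
    ∃ G : Space N → Space N, HasH10Gradient Ω u G ∧ ∀ x, ‖G x‖ ≤ C := by
  have : IsFiniteMeasure (volume.restrict Ω) := ⟨by
    rw [Measure.restrict_apply_univ]; exact hb.measure_lt_top⟩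
  -- Cutting off on `{u = 0}` makes the gradients of the truncations converge to `G` at every point,
  -- without showing that `∇u = 0` almost everywhere on that set.
  set G : Space N → Space N := {x | u x ≠ 0}.indicator (gradient u) with hG
  have hgb : ∀ x, ‖gradient u x‖ ≤ C := fun x => by
    rw [norm_gradient]; exact norm_fderiv_le_of_lipschitz ℝ hu
  have hGb : ∀ x, ‖G x‖ ≤ C := fun x => (norm_indicator_le_norm_self _ _).trans (hgb x)
  have hGm : Measurable G :=
    (measurable_gradient u).indicator (hu.continuous.measurable (measurableSet_singleton 0).compl)
  have huc : HasCompactSupport u := HasCompactSupport.of_support_subset_isCompact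
    hb.isCompact_closure fun x hx => subset_closure (by by_contra h; exact hx (hu0 x h))
  obtain ⟨B, hB⟩ := huc.exists_bound_of_continuous hu.continuous
  let ε : ℕ → ℝ := fun n => 1 / ((n : ℝ) + 1)
  have hε : ∀ n, 0 < ε n := fun n => by positivity
  have hεlim : Tendsto ε atTop (𝓝 0) := tendsto_one_div_add_atTop_nhds_zero_nat
  -- Shrinking the values confines the support to `{|u| ≥ ε n}`, a closed subset of `Ω`, and keeps
  -- the Lipschitz constant.
  let v : ℕ → Space N → ℝ := fun n x => shrink (ε n) (u x)
  have hv : ∀ n, LipschitzWith C (v n) := fun n => by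
    have h := (lipschitzWith_shrink (hε n).le).comp hu
    rwa [one_mul] at h
  have hvs : ∀ n, tsupport (v n) ⊆ {x | ε n ≤ |u x|} := by
    intro n
    refine closure_minimal (fun x hx => ?_) (isClosed_le continuous_const hu.continuous.abs)
    by_contra h
    exact hx (shrink_eq_zero (not_le.1 h).le)
  have hvΩ : ∀ n, tsupport (v n) ⊆ Ω := by
    intro n x hx
    by_contra h
    have h1 : ε n ≤ |u x| := hvs n hx
    rw [hu0 x h, abs_zero] at h1
    exact (hε n).not_ge h1
  have hvc : ∀ n, HasCompactSupport (v n) := fun n =>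
    HasCompactSupport.of_support_subset_isCompact hb.isCompact_closure
      ((subset_tsupport _).trans ((hvΩ n).trans subset_closure))
  choose φ hφ hφ1 hφ2 using fun n => exists_testFunction_near hΩ hb (hv n) (hvc n) (hvΩ n)
    (ε := ENNReal.ofReal (ε n)) (ENNReal.ofReal_pos.2 (hε n))
  have hεlim' : Tendsto (fun n => ENNReal.ofReal (ε n)) atTop (𝓝 0) := by
    simpa using ENNReal.tendsto_ofReal hεlim
  have h1 : Tendsto (fun n => eLpNorm (fun x => v n x - u x) 2 (volume.restrict Ω)) atTop
      (𝓝 0) := by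
    refine tendsto_eLpNorm_two_of_bounded (B := 1) (fun n =>
      ((hv n).continuous.sub hu.continuous).aestronglyMeasurable)
      (fun n => Eventually.of_forall fun x => ?_) (Eventually.of_forall fun x => ?_)
    · refine (abs_shrink_sub_le (hε n).le _).trans ?_
      exact (div_le_one (by positivity)).2 (by simp)
    · exact squeeze_zero_norm (fun n => abs_shrink_sub_le (hε n).le _) hεlim
  have h2 : Tendsto (fun n => eLpNorm (fun x => gradient (v n) x - G x) 2 (volume.restrict Ω))
      atTop (𝓝 0) := by
    refine tendsto_eLpNorm_two_of_bounded (B := C + C) (fun n =>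
      ((measurable_gradient _).sub hGm).aestronglyMeasurable)
      (fun n => Eventually.of_forall fun x => ?_) (Eventually.of_forall fun x => ?_)
    · refine (norm_sub_le _ _).trans (add_le_add ?_ (hGb x))
      rw [norm_gradient]
      exact norm_fderiv_le_of_lipschitz ℝ (hv n)
    · refine tendsto_const_nhds.congr' ?_
      by_cases hx : u x = 0
      · refine Eventually.of_forall fun n => ?_
        have hx' : x ∉ tsupport (v n) := fun h => by
          have h1 : ε n ≤ |u x| := hvs n h
          rw [hx, abs_zero] at h1
          exact (hε n).not_ge h1
        simp [hG, hx, gradient_eq_zero_of_notMem_tsupport hx']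
      · filter_upwards [hεlim.eventually (gt_mem_nhds (abs_pos.2 hx))] with n hn
        have hGx : G x = gradient u x := by simp [hG, hx]
        -- Once `ε n < |u x|`, truncation is locally a shift by a constant, so the derivatives agree
        -- exactly, whether or not `u` is differentiable at `x`.
        have hloc : ∃ c, ∀ᶠ y in 𝓝 x, v n y = u y + c := by
          rcases lt_or_gt_of_ne hx with hneg | hpos
          · rw [abs_of_neg hneg] at hn
            refine ⟨ε n, ?_⟩
            filter_upwards [hu.continuous.continuousAt.eventually
              (gt_mem_nhds (by linarith : u x < -ε n))] with y hy
            have := hε n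
            simp only [v, shrink]
            rw [max_eq_right (by linarith), min_eq_left (by linarith), zero_add]
          · rw [abs_of_pos hpos] at hn
            refine ⟨-ε n, ?_⟩
            filter_upwards [hu.continuous.continuousAt.eventually
              (lt_mem_nhds (by linarith : ε n < u x))] with y hy
            have := hε n
            simp only [v, shrink]
            rw [max_eq_left (by linarith), min_eq_right (by linarith), add_zero, sub_eq_add_neg]
        obtain ⟨c, hc⟩ := hloc
        have : fderiv ℝ (v n) x = fderiv ℝ u x := by
          rw [Filter.EventuallyEq.fderiv_eq hc, fderiv_add_const]
        rw [hGx, gradient, gradient, this, sub_self]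
  refine ⟨G, ⟨MemLp.of_bound hu.continuous.aestronglyMeasurable B (Eventually.of_forall hB),
    MemLp.of_bound hGm.aestronglyMeasurable C (Eventually.of_forall hGb), φ, hφ, ?_, ?_⟩, hGb⟩
  · refine tendsto_of_tendsto_of_tendsto_of_le_of_le tendsto_const_nhds
      (by simpa using hεlim'.add h1) (fun _ => bot_le) fun n => ?_
    have hadd := eLpNorm_add_le (μ := volume.restrict Ω) (p := 2)
      (((hφ n).1.continuous.sub (hv n).continuous).aestronglyMeasurable)
      (((hv n).continuous.sub hu.continuous).aestronglyMeasurable) (by norm_num)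
    refine le_trans (le_of_eq ?_) (hadd.trans (add_le_add (hφ1 n).le le_rfl))
    congr 1
    ext x
    simp
  · refine tendsto_of_tendsto_of_tendsto_of_le_of_le tendsto_const_nhds
      (by simpa using hεlim'.add h2) (fun _ => bot_le) fun n => ?_
    have hadd := eLpNorm_add_le (μ := volume.restrict Ω) (p := 2)
      (f := fun x => gradient (φ n) x - gradient (v n) x) (g := fun x => gradient (v n) x - G x)
      (((measurable_gradient _).sub (measurable_gradient _)).aestronglyMeasurable)
      (((measurable_gradient _).sub hGm).aestronglyMeasurable) (by norm_num)
    refine le_trans (le_of_eq ?_) (hadd.trans (add_le_add (hφ2 n).le le_rfl))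
    congr 1
    ext x
    simp

/-! ### Integration by parts and the transport term. -/

lemma tendsto_integral_mul_of_lintegral {α : Type*} [MeasurableSpace α] {μ : Measure α}
    {F : ℕ → α → ℝ} {f g : α → ℝ} {B : ℝ} (hF : ∀ n, Integrable (F n) μ) (hf : Integrable f μ)
    (hg : AEStronglyMeasurable g μ) (hB : ∀ x, ‖g x‖ ≤ B)
    (h : Tendsto (fun n => ∫⁻ x, ‖F n x - f x‖ₑ ∂μ) atTop (𝓝 0)) :
    Tendsto (fun n => ∫ x, F n x * g x ∂μ) atTop (𝓝 (∫ x, f x * g x ∂μ)) := by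
  refine tendsto_integral_of_L1 _ (hf.mul_bdd hg (Eventually.of_forall hB)).1
    (Eventually.of_forall fun n => (hF n).mul_bdd hg (Eventually.of_forall hB)) ?_
  have h2 := ENNReal.Tendsto.mul_const h (Or.inr (ENNReal.ofReal_ne_top (r := B)))
  rw [zero_mul] at h2
  refine tendsto_of_tendsto_of_tendsto_of_le_of_le tendsto_const_nhds h2 (fun _ => bot_le)
    fun n => ?_
  rw [← lintegral_mul_const' _ _ ENNReal.ofReal_ne_top]
  refine lintegral_mono fun x => ?_
  rw [← sub_mul, enorm_mul]
  gcongr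
  rw [← ofReal_norm]
  exact ENNReal.ofReal_le_ofReal (hB x)

/-- Integration by parts of the weak directional derivative against a Lipschitz function. -/
lemma HasH10Gradient.integral_inner_mul_eq (hb : Bornology.IsBounded Ω)
    {v : Space N → ℝ} {G : Space N → Space N} (h : HasH10Gradient Ω v G) (b : Space N)
    {q : Space N → ℝ} {C : ℝ≥0} (hq : LipschitzWith C q) (hqc : HasCompactSupport q) :
    ∫ x in Ω, inner ℝ b (G x) * q x = ∫ x in Ω, lineDeriv ℝ q x (-b) * v x := by
  have : IsFiniteMeasure (volume.restrict Ω) := ⟨by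
    rw [Measure.restrict_apply_univ]; exact hb.measure_lt_top⟩
  obtain ⟨φ, hφ, hφv, hφG⟩ := h.exists_approx hb
  obtain ⟨B, hB⟩ := hqc.exists_bound_of_continuous hq.continuous
  have hφ0 : ∀ n, ∀ x ∉ Ω, φ n x = 0 := fun n x hx =>
    image_eq_zero_of_notMem_tsupport fun hx' => hx ((hφ n).2.2 hx')
  have hgint : ∀ n, Integrable (gradient (φ n)) volume := fun n =>
    (continuous_gradient (hφ n).1).integrable_of_hasCompactSupport
      ((hφ n).2.1.mono' fun x hx => by
        by_contra h
        exact hx (gradient_eq_zero_of_notMem_tsupport h))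
  have hGint : Integrable G (volume.restrict Ω) := h.2.1.integrable (by norm_num)
  have hvint : Integrable v (volume.restrict Ω) := h.1.integrable (by norm_num)
  have hparts : ∀ n, ∫ x in Ω, inner ℝ b (gradient (φ n) x) * q x =
      ∫ x in Ω, φ n x * lineDeriv ℝ q x (-b) := by
    intro n
    obtain ⟨K, hK⟩ := ContDiff.lipschitzWith_of_hasCompactSupport (hφ n).2.1 (hφ n).1
      (by simp)
    have h1 := hK.integral_lineDeriv_mul_eq (μ := volume) hq hqc b
    have h2 : ∀ x, lineDeriv ℝ (φ n) x b = inner ℝ b (gradient (φ n) x) := fun x => by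
      rw [(((hφ n).1.differentiable (by simp)) x).lineDeriv_eq_fderiv, real_inner_comm]
      simp [gradient]
    rw [setIntegral_eq_integral_of_forall_compl_eq_zero,
      setIntegral_eq_integral_of_forall_compl_eq_zero]
    · simp only [h2] at h1
      rw [h1]
      simp only [mul_comm]
    · intro x hx
      rw [hφ0 n x hx, zero_mul]
    · intro x hx
      rw [gradient_eq_zero_of_notMem_tsupport fun hx' => hx ((hφ n).2.2 hx'), inner_zero_right,
        zero_mul]
  have hl1 : Tendsto (fun n => ∫ x in Ω, inner ℝ b (gradient (φ n) x) * q x) atTop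
      (𝓝 (∫ x in Ω, inner ℝ b (G x) * q x)) := by
    refine tendsto_integral_mul_of_lintegral (fun n => ((hgint n).const_inner b).restrict)
      (hGint.const_inner b) hq.continuous.aestronglyMeasurable hB ?_
    have h2 := ENNReal.Tendsto.const_mul hφG (Or.inr (ENNReal.ofReal_ne_top (r := ‖b‖)))
    rw [mul_zero] at h2
    refine tendsto_of_tendsto_of_tendsto_of_le_of_le tendsto_const_nhds h2 (fun _ => bot_le)
      fun n => ?_
    rw [← lintegral_const_mul' _ _ ENNReal.ofReal_ne_top]
    refine lintegral_mono fun x => ?_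
    rw [← inner_sub_right, ofReal_norm, ← ofReal_norm, ← ofReal_norm, ← ofReal_norm,
      ← ENNReal.ofReal_mul (norm_nonneg _)]
    exact ENNReal.ofReal_le_ofReal (norm_inner_le_norm _ _)
  have hl2 : Tendsto (fun n => ∫ x in Ω, φ n x * lineDeriv ℝ q x (-b)) atTop
      (𝓝 (∫ x in Ω, v x * lineDeriv ℝ q x (-b))) :=
    tendsto_integral_mul_of_lintegral
      (fun n => ((hφ n).1.continuous.integrable_of_hasCompactSupport (hφ n).2.1).restrict)
      hvint (measurable_lineDeriv hq.continuous).aestronglyMeasurable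
      (fun x => norm_lineDeriv_le_of_lipschitz ℝ hq) hφv
  have := tendsto_nhds_unique hl1 (hl2.congr fun n => (hparts n).symm)
  rw [this]
  simp only [mul_comm]

/-- The transport term tested with the truncated gap `(g - u - c)⁺` below a `1`-Lipschitz
function `g`. -/
lemma HasH10Gradient.integral_inner_mul_gap_le (hΩ : IsOpen Ω) (hb : Bornology.IsBounded Ω)
    {v u g : Space N → ℝ} {G : Space N → Space N} (h : HasH10Gradient Ω v G) (b : Space N)
    {C : ℝ≥0} (hu : LipschitzWith C u) (hu0 : ∀ x ∉ Ω, u x = 0) (huv : ∀ x ∈ Ω, u x = v x)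
    (hg : LipschitzWith 1 g) (hg0 : ∀ x ∉ Ω, g x = 0) {c : ℝ} (hc : 0 ≤ c) :
    ∫ x in Ω, inner ℝ b (G x) * max (g x - u x - c) 0 ≤
      ‖b‖ * ∫ x in Ω, max (g x - u x - c) 0 := by
  have hcs : ∀ w : Space N → ℝ, (∀ x ∉ Ω, w x = 0) → HasCompactSupport w := fun w hw =>
    HasCompactSupport.of_support_subset_isCompact hb.isCompact_closure fun x hx =>
      subset_closure (by by_contra h; exact hx (hw x h))
  set w : Space N → ℝ := fun x => g x - u x with hw
  set q : Space N → ℝ := fun x => max (g x - u x - c) 0 with hqdef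
  have hq0 : ∀ x ∉ Ω, q x = 0 := fun x hx => by
    simp [hqdef, hg0 x hx, hu0 x hx, hc]
  have hw0 : ∀ x ∉ Ω, w x = 0 := fun x hx => by simp [hw, hg0 x hx, hu0 x hx]
  have hwl : LipschitzWith (1 + C) w := hg.sub hu
  have hql : LipschitzWith (1 + C) q := by
    have h1 := (hwl.sub (LipschitzWith.const c)).max_const 0
    rwa [add_zero] at h1
  have hqc := hcs q hq0
  have hqm : Measurable fun x => lineDeriv ℝ q x (-b) := measurable_lineDeriv hql.continuous
  have hint : ∀ f : Space N → ℝ, Continuous f → HasCompactSupport f →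
      Integrable fun x => lineDeriv ℝ q x (-b) * f x := fun f hf hfc =>
    (hf.integrable_of_hasCompactSupport hfc).bdd_mul hqm.aestronglyMeasurable
      (Eventually.of_forall fun x => norm_lineDeriv_le_of_lipschitz ℝ hql)
  -- Integrating by parts against `q` itself shows that this integral equals its own negative.
  have hself : ∫ x, lineDeriv ℝ q x (-b) * q x = 0 := by
    have h1 := hql.integral_lineDeriv_mul_eq (μ := volume) hql hqc b
    have h2 : ∫ x, lineDeriv ℝ q x (-b) * q x = -∫ x, lineDeriv ℝ q x b * q x := by
      simp only [lineDeriv_neg, neg_mul, integral_neg]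
    linarith
  have hone : ∫ x, lineDeriv ℝ q x (-b) = 0 := by
    have h1 := (LipschitzWith.const (α := Space N) (1 : ℝ)).integral_lineDeriv_mul_eq
      (μ := volume) hql hqc b
    simpa [lineDeriv] using h1.symm
  -- Where `w < c`, `q` is locally zero and so is its derivative; elsewhere `w = q + c`. With
  -- `hself` and `hone`, the derivative of `q` is therefore orthogonal to `w = g - u`, and `u` may
  -- be replaced by `g`.
  have hpt : ∀ x, lineDeriv ℝ q x (-b) * w x =
      lineDeriv ℝ q x (-b) * q x + c * lineDeriv ℝ q x (-b) := by
    intro x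
    rcases lt_or_ge (w x) c with hlt | hge
    · have hev : q =ᶠ[𝓝 x] fun _ => 0 := by
        filter_upwards [hwl.continuous.continuousAt.eventually (gt_mem_nhds hlt)] with y hy
        exact max_eq_right (by simp only [hw] at hy; linarith)
      have : lineDeriv ℝ q x (-b) = 0 := by
        rw [hev.lineDeriv_eq]
        simp [lineDeriv]
      simp [this]
    · have : q x = w x - c := max_eq_left (sub_nonneg.2 hge)
      rw [this]
      ring
  have hwz : ∫ x, lineDeriv ℝ q x (-b) * w x = 0 := by
    have hi1 := hint q hql.continuous hqc
    have hi2 : Integrable fun x => c * lineDeriv ℝ q x (-b) := by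
      refine ((hint w hwl.continuous (hcs w hw0)).sub hi1).congr (Eventually.of_forall fun x => ?_)
      simp only [Pi.sub_apply, hpt x]
      ring
    simp only [hpt]
    rw [integral_add hi1 hi2, hself, integral_const_mul, hone]
    simp
  -- The derivative is moved back onto `g`, whose slope in direction `b` is at most `‖b‖`; here `q ≥
  -- 0` is needed.
  have hgp : ∫ x, lineDeriv ℝ q x (-b) * g x ≤ ‖b‖ * ∫ x, q x := by
    rw [← hg.integral_lineDeriv_mul_eq (μ := volume) hql hqc b, ← integral_const_mul]
    have hqi := hql.continuous.integrable_of_hasCompactSupport (μ := volume) hqc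
    refine integral_mono (hqi.bdd_mul
      (measurable_lineDeriv hg.continuous).aestronglyMeasurable
      (Eventually.of_forall fun x => norm_lineDeriv_le_of_lipschitz ℝ hg)) (hqi.const_mul _)
      fun x => ?_
    refine mul_le_mul_of_nonneg_right ?_ (le_max_right _ _)
    have := norm_lineDeriv_le_of_lipschitz ℝ hg (x₀ := x) (v := b)
    rw [NNReal.coe_one, one_mul] at this
    exact (le_abs_self _).trans this
  have hparts := h.integral_inner_mul_eq hb b hql hqc
  have hvu : ∫ x in Ω, lineDeriv ℝ q x (-b) * v x = ∫ x, lineDeriv ℝ q x (-b) * u x := by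
    rw [← setIntegral_eq_integral_of_forall_compl_eq_zero (s := Ω)
      (f := fun x => lineDeriv ℝ q x (-b) * u x) fun x hx => by rw [hu0 x hx, mul_zero]]
    exact setIntegral_congr_fun hΩ.measurableSet fun x hx => by simp only [huv x hx]
  have hsub : ∫ x, lineDeriv ℝ q x (-b) * u x =
      (∫ x, lineDeriv ℝ q x (-b) * g x) - ∫ x, lineDeriv ℝ q x (-b) * w x := by
    rw [← integral_sub (hint g hg.continuous (hcs g hg0)) (hint w hwl.continuous (hcs w hw0))]
    refine integral_congr_ae (Eventually.of_forall fun x => ?_)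
    simp only [hw]
    ring
  rw [setIntegral_eq_integral_of_forall_compl_eq_zero (s := Ω) hq0, hparts, hvu, hsub, hwz,
    sub_zero]
  exact hgp

/-! ### Weak derivatives in one variable. -/

lemma ae_restrict_Ioo_of_ae {P : ℝ → Prop} {T : ℝ} (hT : 0 ≤ T)
    (h : ∀ᵐ x, x ∈ uIcc 0 T → P x) : ∀ᵐ x ∂volume.restrict (Ioo 0 T), P x := by
  filter_upwards [ae_restrict_of_ae h, ae_restrict_mem measurableSet_Ioo] with x hx hxT
  rw [uIcc_of_le hT] at hx
  exact hx (Ioo_subset_Icc_self hxT)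

/-- A compactly supported smooth function on `(0, T)` of zero mean is the derivative of another
one. -/
lemma exists_primitive_of_integral_eq_zero {T : ℝ} (hT : 0 < T) {θ : ℝ → ℝ}
    (hθ : ContDiff ℝ ∞ θ) (hθc : HasCompactSupport θ) (hθT : tsupport θ ⊆ Ioo 0 T)
    (h0 : ∫ r in Ioo 0 T, θ r = 0) :
    ∃ η : ℝ → ℝ, ContDiff ℝ ∞ η ∧ HasCompactSupport η ∧ tsupport η ⊆ Ioo 0 T ∧
      deriv η = θ := by
  -- The extra point `T / 2` provides endpoints `a`, `c` even when `θ = 0`.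
  have hK : IsCompact (insert (T / 2) (tsupport θ)) := hθc.isCompact.insert _
  have hne : (insert (T / 2) (tsupport θ)).Nonempty := insert_nonempty _ _
  have hKT : insert (T / 2) (tsupport θ) ⊆ Ioo 0 T :=
    insert_subset ⟨by linarith, by linarith⟩ hθT
  obtain ⟨a, haK, ha⟩ := hK.exists_isLeast hne
  obtain ⟨c, hcK, hc⟩ := hK.exists_isGreatest hne
  have ha0 := (hKT haK).1
  have hcT := (hKT hcK).2
  have hac : a ≤ c := ha hcK
  have hθ0 : ∀ r ∉ Icc a c, θ r = 0 := fun r hr => by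
    by_contra hne
    have hmem := mem_insert_of_mem (T / 2) (subset_tsupport θ hne)
    exact hr ⟨ha hmem, hc hmem⟩
  have hθi : ∀ r s, IntervalIntegrable θ volume r s := fun r s =>
    hθ.continuous.intervalIntegrable r s
  have hd : ∀ r, HasDerivAt (fun r => ∫ x in (0 : ℝ)..r, θ x) (θ r) r := fun r =>
    intervalIntegral.integral_hasDerivAt_right (hθi 0 r)
      (hθ.continuous.stronglyMeasurableAtFilter _ _) hθ.continuous.continuousAt
  have hderiv : deriv (fun r => ∫ x in (0 : ℝ)..r, θ x) = θ := funext fun r => (hd r).deriv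
  have hsupp : Function.support (fun r => ∫ x in (0 : ℝ)..r, θ x) ⊆ Icc a c := by
    intro r hr
    by_contra hrac
    refine hr ?_
    rw [mem_Icc, not_and_or, not_le, not_le] at hrac
    rcases hrac with hra | hcr
    · refine intervalIntegral.integral_zero_ae (Eventually.of_forall fun x hx => hθ0 x fun hx' => ?_)
      have : x ≤ max 0 r := hx.2
      exact absurd hx'.1 (not_le.2 (this.trans_lt (max_lt ha0 hra)))
    · have h1 : ∫ x in (0 : ℝ)..T, θ x = 0 := by
        rw [intervalIntegral.integral_of_le hT.le, integral_Ioc_eq_integral_Ioo, h0]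
      have h2 := intervalIntegral.integral_add_adjacent_intervals (hθi 0 r) (hθi r T)
      have h3 : ∫ x in r..T, θ x = 0 := by
        refine intervalIntegral.integral_zero_ae
          (Eventually.of_forall fun x hx => hθ0 x fun hx' => ?_)
        have : min r T < x := hx.1
        exact absurd hx'.2 (not_le.2 ((lt_min hcr hcT).trans this))
      simp only
      linarith
  refine ⟨fun r => ∫ x in (0 : ℝ)..r, θ x, ?_, ?_, ?_, hderiv⟩
  · rw [contDiff_infty_iff_deriv, hderiv]
    exact ⟨fun r => (hd r).differentiableAt, hθ⟩
  · exact HasCompactSupport.of_support_subset_isCompact isCompact_Icc hsupp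
  · exact (closure_minimal hsupp isClosed_Icc).trans fun r hr =>
      ⟨ha0.trans_le hr.1, hr.2.trans_lt hcT⟩

/-- A continuous function on `(0, T)` with integrable distributional derivative `P` is a primitive
of `P`. -/
lemma sub_eq_integral_of_weakDeriv {T : ℝ} (hT : 0 < T) {Z P : ℝ → ℝ}
    (hZ : ContinuousOn Z (Icc 0 T)) (hP : IntegrableOn P (Ioo 0 T))
    (h : ∀ η : ℝ → ℝ, ContDiff ℝ ∞ η → HasCompactSupport η → tsupport η ⊆ Ioo 0 T →
      ∫ r in Ioo 0 T, Z r * deriv η r = -∫ r in Ioo 0 T, P r * η r)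
    {s t : ℝ} (hs : s ∈ Ioo 0 T) (ht : t ∈ Ioo 0 T) : Z t - Z s = ∫ r in s..t, P r := by
  have hPi : IntervalIntegrable P volume 0 T := by
    rw [intervalIntegrable_iff_integrableOn_Ioo_of_le hT.le]; exact hP
  set A : ℝ → ℝ := fun r => ∫ x in (0 : ℝ)..r, P x with hA
  have hAac : AbsolutelyContinuousOnInterval A 0 T :=
    hPi.absolutelyContinuousOnInterval_intervalIntegral (by simp)
  have hAc : ContinuousOn A (Icc 0 T) := by
    rw [← uIcc_of_le hT.le]; exact hAac.continuousOn
  have hAd : ∀ᵐ r ∂volume.restrict (Ioo 0 T), deriv A r = P r := by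
    refine ae_restrict_Ioo_of_ae hT.le ?_
    filter_upwards [hPi.ae_hasDerivAt_integral] with r hr hrT
    exact (hr hrT 0 (by simp)).deriv
  have hAη : ∀ η : ℝ → ℝ, ContDiff ℝ ∞ η → tsupport η ⊆ Ioo 0 T →
      ∫ r in Ioo 0 T, A r * deriv η r = -∫ r in Ioo 0 T, P r * η r := by
    intro η hη hηT
    have hηac : AbsolutelyContinuousOnInterval η 0 T :=
      (hη.of_le (by simp)).contDiffOn.absolutelyContinuousOnInterval
    have hη0 : ∀ r ∉ Ioo 0 T, η r = 0 := fun r hr =>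
      image_eq_zero_of_notMem_tsupport fun h' => hr (hηT h')
    have hip := hAac.integral_mul_deriv_eq_deriv_mul hηac
    rw [hη0 0 (by simp), hη0 T (by simp), intervalIntegral.integral_of_le hT.le,
      intervalIntegral.integral_of_le hT.le, integral_Ioc_eq_integral_Ioo,
      integral_Ioc_eq_integral_Ioo, mul_zero, mul_zero, sub_zero, zero_sub] at hip
    rw [hip]
    congr 1
    refine integral_congr_ae ?_
    filter_upwards [hAd] with r hr
    rw [hr]
  -- By the du Bois-Reymond argument, `W` has zero weak derivative and is therefore constant.
  set W : ℝ → ℝ := fun r => Z r - A r with hW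
  have hWc : ContinuousOn W (Icc 0 T) := hZ.sub hAc
  have hmulint : ∀ {F g : ℝ → ℝ}, ContinuousOn F (Icc 0 T) → Continuous g →
      IntegrableOn (fun r => F r * g r) (Ioo 0 T) := fun hF hg =>
    ((hF.mul hg.continuousOn).integrableOn_Icc).mono_set Ioo_subset_Icc_self
  have hWη : ∀ η : ℝ → ℝ, ContDiff ℝ ∞ η → HasCompactSupport η → tsupport η ⊆ Ioo 0 T →
      ∫ r in Ioo 0 T, W r * deriv η r = 0 := by
    intro η hη hηc hηT
    have hηd : Continuous (deriv η) := hη.continuous_deriv (by simp)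
    simp only [hW, sub_mul]
    rw [integral_sub (hmulint hZ hηd) (hmulint hAc hηd), h η hη hηc hηT, hAη η hη hηT, sub_self]
  obtain ⟨ψ₀, hψ₀, hψ₀c, hψ₀T, hψ₀1⟩ : ∃ ψ : ℝ → ℝ, ContDiff ℝ ∞ ψ ∧ HasCompactSupport ψ ∧
      tsupport ψ ⊆ Ioo 0 T ∧ ∫ r in Ioo 0 T, ψ r = 1 := by
    let B : ContDiffBump (T / 2) :=
      { rIn := T / 8, rOut := T / 4, rIn_pos := by positivity, rIn_lt_rOut := by linarith }
    have hB : tsupport (B.normed volume) ⊆ Ioo 0 T := by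
      rw [B.tsupport_normed_eq, Real.closedBall_eq_Icc]
      intro r hr
      simp only [B, mem_Icc] at hr
      exact ⟨by linarith, by linarith⟩
    refine ⟨B.normed volume, B.contDiff_normed, B.hasCompactSupport_normed, hB, ?_⟩
    rw [setIntegral_eq_integral_of_forall_compl_eq_zero, B.integral_normed]
    exact fun r hr => image_eq_zero_of_notMem_tsupport fun h' => hr (hB h')
  set c := ∫ r in Ioo 0 T, W r * ψ₀ r with hc
  have hconst : ∀ᵐ r, r ∈ Ioo 0 T → W r - c = 0 := by
    refine isOpen_Ioo.ae_eq_zero_of_integral_contDiff_smul_eq_zero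
      (((hWc.mono Ioo_subset_Icc_self).sub continuousOn_const).locallyIntegrableOn
        measurableSet_Ioo) fun ψ hψ hψc hψT => ?_
    set m := ∫ r in Ioo 0 T, ψ r with hm
    have hi : ∀ g : ℝ → ℝ, Continuous g → IntegrableOn g (Ioo 0 T) := fun g hg =>
      (hg.continuousOn.integrableOn_Icc).mono_set Ioo_subset_Icc_self
    -- Subtracting `m ψ₀`, with `ψ₀` of unit mass, gives zero mean, so the difference is an
    -- admissible `η'`; testing `W` with it identifies `c` as the constant.
    obtain ⟨η, hη, hηc, hηT, hηd⟩ := exists_primitive_of_integral_eq_zero hT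
      (θ := fun r => ψ r - m * ψ₀ r) (hψ.sub (contDiff_const.mul hψ₀)) (hψc.sub hψ₀c.mul_left)
      ((tsupport_sub _ _).trans (union_subset hψT ((closure_mono
        (Function.support_mul_subset_right _ _)).trans hψ₀T))) (by
        have hmψ₀ : IntegrableOn (fun r => m * ψ₀ r) (Ioo 0 T) :=
          hi _ (continuous_const.mul hψ₀.continuous)
        rw [integral_sub (hi _ hψ.continuous) hmψ₀, integral_const_mul, hψ₀1, mul_one, sub_self])
    have hz := hWη η hη hηc hηT
    rw [hηd] at hz
    have e1 : ∫ r in Ioo 0 T, W r * (ψ r - m * ψ₀ r) = (∫ r in Ioo 0 T, W r * ψ r) - m * c := by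
      rw [hc, ← integral_const_mul, ← integral_sub (hmulint hWc hψ.continuous)
        ((hmulint hWc hψ₀.continuous).const_mul m)]
      refine integral_congr_ae (Eventually.of_forall fun r => ?_)
      simp only
      ring
    have e2 : ∫ r in Ioo 0 T, ψ r • (W r - c) = (∫ r in Ioo 0 T, W r * ψ r) - m * c := by
      rw [hm, ← integral_mul_const, ← integral_sub (hmulint hWc hψ.continuous)
        ((hi _ hψ.continuous).mul_const c)]
      refine integral_congr_ae (Eventually.of_forall fun r => ?_)
      simp only [smul_eq_mul]
      ring
    rw [← setIntegral_eq_integral_of_forall_compl_eq_zero (s := Ioo 0 T), e2, ← e1, hz]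
    intro r hr
    rw [image_eq_zero_of_notMem_tsupport fun h' => hr (hψT h'), zero_smul]
  have heq : EqOn W (fun _ => c) (Ioo 0 T) := by
    refine Measure.eqOn_open_of_ae_eq (μ := volume) ?_ isOpen_Ioo (hWc.mono Ioo_subset_Icc_self)
      continuousOn_const
    rw [EventuallyEq, ae_restrict_iff' measurableSet_Ioo]
    filter_upwards [hconst] with r hr hrT
    exact sub_eq_zero.1 (hr hrT)
  have h1 := heq hs
  have h2 := heq ht
  have hii : ∀ {r}, r ∈ Ioo 0 T → IntervalIntegrable P volume 0 r := fun {r} hr =>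
    hPi.mono_set (by
      rw [uIcc_of_le hT.le, uIcc_of_le hr.1.le]
      exact Icc_subset_Icc_right hr.2.le)
  have h3 := intervalIntegral.integral_interval_sub_left (hii ht) (hii hs)
  simp only [hW, hA] at h1 h2
  linarith

/-! ### The chain rule for the squared positive part. -/

/-- Squaring removes the kink of the positive part: near zero the function is `O(y²)`. Hence the
chain rule needs no case distinction at zeros of the inner function. -/
lemma hasDerivAt_sq_max_zero (y : ℝ) :
    HasDerivAt (fun y : ℝ => max y 0 * max y 0) (2 * max y 0) y := by
  rcases lt_trichotomy y 0 with hy | rfl | hy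
  · rw [max_eq_right hy.le, mul_zero]
    refine (hasDerivAt_const y (0 : ℝ)).congr_of_eventuallyEq ?_
    filter_upwards [gt_mem_nhds hy] with z hz
    rw [max_eq_right hz.le, mul_zero]
  · rw [max_self, mul_zero, hasDerivAt_iff_isLittleO]
    simp only [max_self, mul_zero, sub_zero, smul_zero]
    have h1 : (fun y : ℝ => max y 0 * max y 0) =O[𝓝 0] fun y : ℝ => y * y := by
      refine Asymptotics.isBigO_of_le _ fun y => ?_
      rw [norm_mul, norm_mul]
      have : ‖max y 0‖ ≤ ‖y‖ := by
        rw [Real.norm_eq_abs, Real.norm_eq_abs, abs_of_nonneg (le_max_right _ _)]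
        exact max_le (le_abs_self y) (abs_nonneg y)
      gcongr
    refine h1.trans_isLittleO ?_
    have h2 : (fun y : ℝ => y) =o[𝓝 0] fun _ => (1 : ℝ) :=
      (Asymptotics.isLittleO_one_iff ℝ).2 tendsto_id
    simpa using h2.mul_isBigO (Asymptotics.isBigO_refl (fun y : ℝ => y) (𝓝 0))
  · rw [max_eq_left hy.le]
    have h1 : HasDerivAt (fun z : ℝ => z * z) (2 * y) y := by
      have := (hasDerivAt_id y).mul (hasDerivAt_id y)
      simpa [two_mul] using! this
    refine h1.congr_of_eventuallyEq ?_
    filter_upwards [lt_mem_nhds hy] with z hz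
    rw [max_eq_left hz.le]

lemma _root_.AbsolutelyContinuousOnInterval.max_zero {g : ℝ → ℝ} {s t : ℝ}
    (hg : AbsolutelyContinuousOnInterval g s t) :
    AbsolutelyContinuousOnInterval (fun r => max (g r) 0) s t := by
  refine squeeze_zero (fun E => Finset.sum_nonneg fun i _ => dist_nonneg)
    (fun E => Finset.sum_le_sum fun i _ => ?_) hg
  simp only [Real.dist_eq]
  exact abs_max_sub_max_le_abs _ _ _

/-- The chain rule for the square of the positive part of a primitive. -/
lemma sq_max_sub_eq_integral {g r : ℝ → ℝ} {s t : ℝ} (hst : s ≤ t)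
    (hr : IntervalIntegrable r volume s t)
    (hg : ∀ τ ∈ Icc s t, g τ = g s + ∫ x in s..τ, r x) :
    max (g t) 0 * max (g t) 0 - max (g s) 0 * max (g s) 0 =
      ∫ τ in s..t, 2 * max (g τ) 0 * r τ := by
  set k : ℝ → ℝ := fun τ => g s + ∫ x in s..τ, r x with hk
  have hconst : AbsolutelyContinuousOnInterval (fun _ : ℝ => g s) s t :=
    contDiff_const.contDiffOn.absolutelyContinuousOnInterval
  have hkac : AbsolutelyContinuousOnInterval k s t :=
    hconst.add (hr.absolutelyContinuousOnInterval_intervalIntegral (by simp))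
  have hm := hkac.max_zero
  have hftc := (hm.fun_mul hm).integral_deriv_eq_sub
  rw [hg t (right_mem_Icc.2 hst), show max (g s) 0 = max (k s) 0 by simp [hk]]
  rw [← hftc]
  refine intervalIntegral.integral_congr_ae ?_
  filter_upwards [hr.ae_hasDerivAt_integral] with τ hτ hτ'
  have hτI := uIoc_subset_uIcc hτ'
  have hkd : HasDerivAt k (r τ) τ := (hτ hτI s (by simp)).const_add (g s)
  have hd : HasDerivAt (fun i => max (k i) 0 * max (k i) 0) (2 * max (k τ) 0 * r τ) τ :=
    (hasDerivAt_sq_max_zero (k τ)).comp τ hkd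
  rw [hd.deriv, hg τ (by rwa [uIcc_of_le hst] at hτI)]

/-! ### Weak time derivatives on the cylinder. -/

lemma restrict_prod_eq (I : Set ℝ) : (volume : Measure (ℝ × Space N)).restrict (I ×ˢ Ω) =
    (volume.restrict I).prod (volume.restrict Ω) := by
  rw [Measure.volume_eq_prod, Measure.prod_restrict]

lemma tsupport_mul_prod_subset (η : ℝ → ℝ) (χ : Space N → ℝ) :
    tsupport (fun q : ℝ × Space N => η q.1 * χ q.2) ⊆ tsupport η ×ˢ tsupport χ := by
  refine closure_minimal (fun q hq => ?_) ((isClosed_tsupport η).prod (isClosed_tsupport χ))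
  exact ⟨subset_tsupport _ (left_ne_zero_of_mul hq), subset_tsupport _ (right_ne_zero_of_mul hq)⟩

lemma hasCompactSupport_mul_prod {η : ℝ → ℝ} {χ : Space N → ℝ} (hη : HasCompactSupport η)
    (hχ : HasCompactSupport χ) : HasCompactSupport fun q : ℝ × Space N => η q.1 * χ q.2 :=
  (hη.isCompact.prod hχ.isCompact).of_isClosed_subset (isClosed_tsupport _)
    (tsupport_mul_prod_subset η χ)

lemma continuousOn_slice {T : ℝ} {z : ℝ → Space N → ℝ}
    (hz : ContinuousOn (fun q : ℝ × Space N => z q.1 q.2) (Icc 0 T ×ˢ closure Ω)) {r : ℝ}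
    (hr : r ∈ Icc 0 T) : ContinuousOn (z r) (closure Ω) :=
  hz.comp (f := fun x => (r, x)) (by fun_prop) fun _ hx => ⟨hr, hx⟩

lemma continuousOn_path {T : ℝ} {z : ℝ → Space N → ℝ}
    (hz : ContinuousOn (fun q : ℝ × Space N => z q.1 q.2) (Icc 0 T ×ˢ closure Ω)) {x : Space N}
    (hx : x ∈ closure Ω) : ContinuousOn (fun r => z r x) (Icc 0 T) :=
  hz.comp (f := fun r => (r, x)) (by fun_prop) fun _ hr => ⟨hr, hx⟩

/-- At two given times, a continuous function differs by the integral of its weak time derivative,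
almost everywhere in `Ω`. -/
lemma HasWeakTimeDeriv.ae_sub_eq_integral (hΩ : IsOpen Ω) (hb : Bornology.IsBounded Ω) {T : ℝ}
    (hT : 0 < T) {z p : ℝ → Space N → ℝ}
    (hz : ContinuousOn (fun q : ℝ × Space N => z q.1 q.2) (Icc 0 T ×ˢ closure Ω))
    (hp : IntegrableOn (fun q : ℝ × Space N => p q.1 q.2) (cylinder Ω T))
    (h : HasWeakTimeDeriv Ω T z p) {s t : ℝ} (hs : s ∈ Ioo 0 T) (ht : t ∈ Ioo 0 T)
    (hst : s ≤ t) :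
    ∀ᵐ x ∂volume.restrict Ω, z t x - z s x = ∫ r in s..t, p r x := by
  have : IsFiniteMeasure (volume.restrict Ω) := ⟨by
    rw [Measure.restrict_apply_univ]; exact hb.measure_lt_top⟩
  obtain ⟨B, hB⟩ := (isCompact_Icc.prod hb.isCompact_closure).exists_bound_of_continuousOn hz
  have hzi : IntegrableOn (fun q : ℝ × Space N => z q.1 q.2) (cylinder Ω T) :=
    (hz.integrableOn_compact (isCompact_Icc.prod hb.isCompact_closure)).mono_set
      (prod_mono Ioo_subset_Icc_self subset_closure)
  have hpst : IntegrableOn (fun q : ℝ × Space N => p q.1 q.2) (Ioc s t ×ˢ Ω) :=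
    hp.mono_set (prod_mono (fun r hr => ⟨hs.1.trans hr.1, hr.2.trans_lt ht.2⟩) subset_rfl)
  rw [IntegrableOn, cylinder, restrict_prod_eq] at hzi hp
  rw [IntegrableOn, restrict_prod_eq] at hpst
  have hzr : ∀ r ∈ Icc 0 T, IntegrableOn (z r) Ω := fun r hr =>
    ((continuousOn_slice hz hr).integrableOn_compact hb.isCompact_closure).mono_set subset_closure
  have hDi : IntegrableOn (fun x => z t x - z s x - ∫ r in s..t, p r x) Ω := by
    refine ((hzr t (Ioo_subset_Icc_self ht)).sub (hzr s (Ioo_subset_Icc_self hs))).sub ?_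
    simp only [intervalIntegral.integral_of_le hst]
    exact hpst.integral_prod_right
  have hae := hΩ.ae_eq_zero_of_integral_contDiff_smul_eq_zero (μ := volume)
    (f := fun x => z t x - z s x - ∫ r in s..t, p r x)
    (hDi.locallyIntegrableOn) fun χ hχ hχc hχΩ => ?_
  · rw [ae_restrict_iff' hΩ.measurableSet]
    filter_upwards [hae] with x hx hxΩ
    exact sub_eq_zero.1 (hx hxΩ)
  obtain ⟨Bχ, hBχ⟩ := hχc.exists_bound_of_continuous hχ.continuous
  have hmulχ : ∀ {g : Space N → ℝ}, IntegrableOn g Ω →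
      Integrable (fun x => g x * χ x) (volume.restrict Ω) := fun hg =>
    Integrable.mul_bdd hg hχ.continuous.aestronglyMeasurable (Eventually.of_forall hBχ)
  have hmulχ' : ∀ {F : ℝ × Space N → ℝ} {I : Set ℝ},
      Integrable F ((volume.restrict I).prod (volume.restrict Ω)) →
      Integrable (fun q => F q * χ q.2) ((volume.restrict I).prod (volume.restrict Ω)) :=
    fun hF => Integrable.mul_bdd hF (hχ.continuous.comp continuous_snd).aestronglyMeasurable
      (Eventually.of_forall fun q => hBχ q.2)
  have hfub : ∀ {w : ℝ → Space N → ℝ} {g : ℝ → ℝ}, Continuous g → HasCompactSupport g →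
      Integrable (fun q : ℝ × Space N => w q.1 q.2)
        ((volume.restrict (Ioo 0 T)).prod (volume.restrict Ω)) →
      ∫ q in cylinder Ω T, w q.1 q.2 * (g q.1 * χ q.2) =
        ∫ r in Ioo 0 T, (∫ x in Ω, w r x * χ x) * g r := by
    intro w g hg hgc hw
    obtain ⟨B', hB'⟩ := (hasCompactSupport_mul_prod hgc hχc).exists_bound_of_continuous
      (by fun_prop)
    rw [cylinder, restrict_prod_eq, integral_prod]
    · refine integral_congr_ae (Eventually.of_forall fun r => ?_)
      simp only
      rw [← integral_mul_const]
      refine integral_congr_ae (Eventually.of_forall fun x => ?_)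
      simp only
      ring
    · exact Integrable.mul_bdd hw (by fun_prop) (Eventually.of_forall hB')
  have hZ : ContinuousOn (fun r => ∫ x in Ω, z r x * χ x) (Icc 0 T) := by
    refine continuousOn_of_dominated (bound := fun _ => B * Bχ) (fun r hr => ?_) (fun r hr => ?_)
      (integrable_const _) ?_
    · exact (hmulχ (hzr r hr)).1
    · filter_upwards [ae_restrict_mem hΩ.measurableSet] with x hx
      rw [norm_mul]
      have h1 := hB (r, x) ⟨hr, subset_closure hx⟩
      exact mul_le_mul h1 (hBχ x) (norm_nonneg _) ((norm_nonneg _).trans h1)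
    · filter_upwards [ae_restrict_mem hΩ.measurableSet] with x hx
      exact (continuousOn_path hz (subset_closure hx)).mul continuousOn_const
  have hP : IntegrableOn (fun r => ∫ x in Ω, p r x * χ x) (Ioo 0 T) :=
    (hmulχ' hp).integral_prod_left
  -- Separated test functions `η(r) χ(x)` reduce the claim, for each fixed `χ`, to the one-variable
  -- statement for `r ↦ ∫ z r χ`.
  have hkey := sub_eq_integral_of_weakDeriv hT hZ hP (fun η hη hηc hηT => by
    have hηd : Continuous (deriv η) := hη.continuous_deriv (by simp)
    have h1 := h (fun q => η q.1 * χ q.2) ((hη.comp contDiff_fst).mul (hχ.comp contDiff_snd))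
      (hasCompactSupport_mul_prod hηc hχc)
      ((tsupport_mul_prod_subset η χ).trans (prod_mono hηT hχΩ))
    have h2 : ∀ q : ℝ × Space N, fderiv ℝ (fun q : ℝ × Space N => η q.1 * χ q.2) q (1, 0) =
        deriv η q.1 * χ q.2 := by
      intro q
      have e1 : HasFDerivAt (fun q : ℝ × Space N => η q.1)
          ((fderiv ℝ η q.1).comp (ContinuousLinearMap.fst ℝ ℝ (Space N))) q :=
        (((hη.differentiable (by simp)) q.1).hasFDerivAt).comp q hasFDerivAt_fst
      have e2 : HasFDerivAt (fun q : ℝ × Space N => χ q.2)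
          ((fderiv ℝ χ q.2).comp (ContinuousLinearMap.snd ℝ ℝ (Space N))) q :=
        (((hχ.differentiable (by simp)) q.2).hasFDerivAt).comp q hasFDerivAt_snd
      rw [(e1.fun_mul e2).fderiv]
      simp [mul_comm]
    simp only [h2] at h1
    rw [hfub hηd hηc.deriv hzi, hfub hη.continuous hηc hp] at h1
    exact h1) hs ht
  have hswap : ∫ r in s..t, ∫ x in Ω, p r x * χ x = ∫ x in Ω, (∫ r in s..t, p r x) * χ x := by
    simp only [intervalIntegral.integral_of_le hst]
    rw [integral_integral_swap (hmulχ' hpst)]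
    simp only [integral_mul_const]
  have hPi : IntegrableOn (fun x => ∫ r in s..t, p r x) Ω := by
    simp only [intervalIntegral.integral_of_le hst]
    exact hpst.integral_prod_right
  rw [← setIntegral_eq_integral_of_forall_compl_eq_zero (s := Ω) fun x hx => by
    rw [image_eq_zero_of_notMem_tsupport fun h' => hx (hχΩ h'), zero_smul]]
  have hsplit : ∫ x in Ω, χ x • (z t x - z s x - ∫ r in s..t, p r x) =
      (∫ x in Ω, z t x * χ x) - (∫ x in Ω, z s x * χ x) -
        ∫ x in Ω, (∫ r in s..t, p r x) * χ x := by
    have i1 := hmulχ (hzr t (Ioo_subset_Icc_self ht))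
    have i2 := hmulχ (hzr s (Ioo_subset_Icc_self hs))
    have i3 : Integrable (fun x => z t x * χ x - z s x * χ x) (volume.restrict Ω) := i1.sub i2
    rw [← integral_sub i1 i2, ← integral_sub i3 (hmulχ hPi)]
    refine integral_congr_ae (Eventually.of_forall fun x => ?_)
    simp only [smul_eq_mul]
    ring
  rw [hsplit, hkey, hswap, sub_self]

/-- Almost every path of a continuous function with integrable weak time derivative is a primitive
of that derivative. -/
lemma HasWeakTimeDeriv.ae_forall_eq_add_integral (hΩ : IsOpen Ω) (hb : Bornology.IsBounded Ω)
    {T : ℝ} (hT : 0 < T) {z p : ℝ → Space N → ℝ}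
    (hz : ContinuousOn (fun q : ℝ × Space N => z q.1 q.2) (Icc 0 T ×ˢ closure Ω))
    (hp : IntegrableOn (fun q : ℝ × Space N => p q.1 q.2) (cylinder Ω T))
    (h : HasWeakTimeDeriv Ω T z p) {s t : ℝ} (hs : s ∈ Ioo 0 T) (ht : t ∈ Ioo 0 T)
    (hst : s ≤ t) :
    ∀ᵐ x ∂volume.restrict Ω, IntervalIntegrable (fun r => p r x) volume s t ∧
      ∀ τ ∈ Icc s t, z τ x = z s x + ∫ r in s..τ, p r x := by
  have hpst : IntegrableOn (fun q : ℝ × Space N => p q.1 q.2) (Ioc s t ×ˢ Ω) :=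
    hp.mono_set (prod_mono (fun r hr => ⟨hs.1.trans hr.1, hr.2.trans_lt ht.2⟩) subset_rfl)
  rw [IntegrableOn, restrict_prod_eq] at hpst
  have hsub : Icc s t ⊆ Icc 0 T := Icc_subset_Icc hs.1.le ht.2.le
  -- The exceptional null set depends on the time. Rational times share one null set, and continuity
  -- in time of both sides gives all `τ`.
  have hrat : ∀ᵐ x ∂volume.restrict Ω, ∀ r : ℚ, (r : ℝ) ∈ Icc s t →
      z r x - z s x = ∫ τ in s..(r : ℝ), p τ x := by
    rw [ae_all_iff]
    intro r
    by_cases hr : (r : ℝ) ∈ Icc s t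
    · filter_upwards [h.ae_sub_eq_integral hΩ hb hT hz hp hs
        ⟨hs.1.trans_le hr.1, hr.2.trans_lt ht.2⟩ hr.1] with x hx _
      exact hx
    · exact Eventually.of_forall fun x hx => absurd hx hr
  filter_upwards [hrat, hpst.prod_left_ae, ae_restrict_mem hΩ.measurableSet] with x hx hxi hxΩ
  have hii : IntervalIntegrable (fun r => p r x) volume s t := by
    rw [intervalIntegrable_iff_integrableOn_Ioc_of_le hst]
    exact hxi
  refine ⟨hii, ?_⟩
  rcases hst.eq_or_lt with rfl | hlt
  · intro τ hτ
    obtain rfl : τ = s := le_antisymm hτ.2 hτ.1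
    simp
  have heq : EqOn (fun τ => z τ x) (fun τ => z s x + ∫ r in s..τ, p r x) (Icc s t) := by
    refine EqOn.of_subset_closure (s := Ioo s t ∩ range ((↑) : ℚ → ℝ)) ?_
      ((continuousOn_path hz (subset_closure hxΩ)).mono hsub) ?_
      (inter_subset_left.trans Ioo_subset_Icc_self) ?_
    · rintro _ ⟨hr, r, rfl⟩
      exact (eq_add_of_sub_eq' (hx r (Ioo_subset_Icc_self hr)))
    · refine continuousOn_const.add ?_
      have := (hii.absolutelyContinuousOnInterval_intervalIntegral
        (c := s) (by simp)).continuousOn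
      rwa [uIcc_of_le hst] at this
    · rw [← closure_Ioo hlt.ne]
      exact closure_minimal (Dense.open_subset_closure_inter Rat.denseRange_cast isOpen_Ioo)
        isClosed_closure
  exact heq

/-! ### Admissibility of the test function and the energy estimate. -/

/-- A set of full measure is dense when open sets have positive measure, so continuity upgrades the
inequality. It is used both in space and in time. -/
lemma le_of_ae_restrict_le {X : Type*} [TopologicalSpace X] [MeasurableSpace X]
    [OpensMeasurableSpace X] {μ : Measure X} [μ.IsOpenPosMeasure] {U : Set X} (hU : IsOpen U)
    {f g : X → ℝ} (hf : ContinuousOn f U) (hg : ContinuousOn g U)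
    (h : ∀ᵐ x ∂μ.restrict U, f x ≤ g x) : ∀ x ∈ U, f x ≤ g x := by
  intro x hx
  rw [ae_restrict_iff' hU.measurableSet] at h
  have hfr := (mem_closure_iff_frequently.1 (Measure.dense_of_ae h x)).and_eventually
    (hU.mem_nhds hx)
  have hlim : Tendsto (fun y => f y - g y) (𝓝 x) (𝓝 (f x - g x)) :=
    (hf.continuousAt (hU.mem_nhds hx)).sub (hg.continuousAt (hU.mem_nhds hx))
  exact sub_nonpos.1 (le_of_tendsto_of_frequently hlim
    (hfr.mono fun y hy => sub_nonpos.2 (hy.1 hy.2)))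

lemma infDist_compl_eq_zero {x : Space N} (hx : x ∉ Ω) : Metric.infDist x Ωᶜ = 0 :=
  Metric.infDist_zero_of_mem hx

lemma abs_le_infDist_compl_of_lipschitz (hc : Ωᶜ.Nonempty) {u : Space N → ℝ}
    (hu : LipschitzWith 1 u) (hu0 : ∀ x ∉ Ω, u x = 0) (x : Space N) :
    |u x| ≤ Metric.infDist x Ωᶜ := by
  rw [Metric.le_infDist hc]
  intro y hy
  have := hu.dist_le_mul x y
  rwa [hu0 y hy, Real.dist_eq, sub_zero, NNReal.coe_one, one_mul] at this

/-- Either convex set is stable under `v ↦ max (d - c) v`, and its elements lie between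
`-d` and `d`. -/
lemma mem_convexSet_properties (hΩ : IsOpen Ω) (hb : Bornology.IsBounded Ω)
    (hf : frontier Ω ⊆ closure (closure Ω)ᶜ) (hne : Ωᶜ.Nonempty) {K : Set (Space N → ℝ)}
    (hK : K = gradientSet Ω ∨ K = obstacleSet Ω) {v : Space N → ℝ} (hv : ContinuousOn v Ω)
    {M : ℝ≥0} (hvl : LipschitzWith M (Ω.indicator v)) (hvK : v ∈ K) :
    (∀ x ∈ Ω, |v x| ≤ Metric.infDist x Ωᶜ) ∧
      ∀ c : ℝ, 0 ≤ c →
        (fun x => max (Metric.infDist x Ωᶜ - c) (Ω.indicator v x)) ∈ K := by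
  have hdl : LipschitzWith 1 fun x : Space N => Metric.infDist x Ωᶜ :=
    Metric.lipschitz_infDist_pt _
  have hdcl : ∀ c : ℝ, LipschitzWith 1 fun x : Space N => Metric.infDist x Ωᶜ - c := fun c => by
    simpa using! hdl.sub (LipschitzWith.const c)
  have hu0 : ∀ x ∉ Ω, Ω.indicator v x = 0 := fun x hx => indicator_of_notMem hx v
  have hmax0 : ∀ c : ℝ, 0 ≤ c → ∀ x ∉ Ω,
      max (Metric.infDist x Ωᶜ - c) (Ω.indicator v x) = 0 := fun c hc x hx => by
    rw [hu0 x hx, infDist_compl_eq_zero hx, zero_sub, max_eq_right (by linarith)]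
  rcases hK with rfl | rfl
  · obtain ⟨G, hG, hG1⟩ := hvK
    have hl1 : LipschitzWith 1 (Ω.indicator v) := hG.lipschitzWith hΩ hb hf hv (by simpa using hG1)
    refine ⟨fun x hx => ?_, fun c hc => ?_⟩
    · have := abs_le_infDist_compl_of_lipschitz hne hl1 hu0 x
      rwa [indicator_of_mem hx] at this
    -- The maximum of two 1-Lipschitz functions is 1-Lipschitz, so the gradient constraint survives.
    · have hl := (hdcl c).max hl1
      rw [max_self] at hl
      obtain ⟨G', hG', hb'⟩ := exists_hasH10Gradient_of_lipschitz hΩ hb hl (hmax0 c hc)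
      exact ⟨G', hG', Eventually.of_forall fun x => by simpa using hb' x⟩
  · obtain ⟨-, hvd⟩ := hvK
    have hvd' : ∀ᵐ x ∂volume.restrict Ω, |v x| ≤ Metric.infDist x Ωᶜ := by
      filter_upwards [hvd, ae_restrict_mem hΩ.measurableSet] with x hx hxΩ
      rw [bdist_eq_infDist_compl hΩ hne (subset_closure hxΩ)] at hx
      exact abs_le.2 hx
    have habs : ∀ x ∈ Ω, |v x| ≤ Metric.infDist x Ωᶜ :=
      le_of_ae_restrict_le hΩ hv.abs hdl.continuous.continuousOn hvd'
    refine ⟨habs, fun c hc => ?_⟩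
    -- For the obstacle set any Lipschitz constant will do: the gradient bound is only needed for
    -- membership in `H¹₀`.
    obtain ⟨G', hG', -⟩ := exists_hasH10Gradient_of_lipschitz hΩ hb ((hdcl c).max hvl) (hmax0 c hc)
    refine ⟨⟨G', hG'⟩, ?_⟩
    filter_upwards [ae_restrict_mem hΩ.measurableSet] with x hx
    rw [bdist_eq_infDist_compl hΩ hne (subset_closure hx), indicator_of_mem hx]
    obtain ⟨h1, h2⟩ := abs_le.1 (habs x hx)
    exact ⟨h1.trans (le_max_right _ _), max_le (by linarith) h2⟩

/-- The variational inequality at a fixed time, tested with `max (d - c) z`. -/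
lemma setIntegral_gap_le (hΩ : IsOpen Ω) (hb : Bornology.IsBounded Ω)
    {b : Space N} {v p : Space N → ℝ} {G : Space N → Space N} {K : Set (Space N → ℝ)}
    (hG : HasH10Gradient Ω v G) {M : ℝ≥0} (hvl : LipschitzWith M (Ω.indicator v))
    {a δ c : ℝ} (ha : ‖b‖ + δ ≤ a) (hc : 0 ≤ c)
    (hmem : (fun x => max (Metric.infDist x Ωᶜ - c) (Ω.indicator v x)) ∈ K)
    (hvi : ∀ w ∈ K, ∫ x in Ω, a * (w x - v x) ≤
      (∫ x in Ω, p x * (w x - v x)) + ∫ x in Ω, inner ℝ b (G x) * (w x - v x)) :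
    δ * ∫ x in Ω, max (Metric.infDist x Ωᶜ - v x - c) 0 ≤
      ∫ x in Ω, p x * max (Metric.infDist x Ωᶜ - v x - c) 0 := by
  have htr := hG.integral_inner_mul_gap_le hΩ hb b hvl (fun x hx => indicator_of_notMem hx v)
    (fun x hx => indicator_of_mem hx v) (Metric.lipschitz_infDist_pt Ωᶜ)
    (fun x hx => infDist_compl_eq_zero hx) hc
  have hq : ∀ x ∈ Ω, max (Metric.infDist x Ωᶜ - c) (Ω.indicator v x) - v x =
      max (Metric.infDist x Ωᶜ - v x - c) 0 := fun x hx => by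
    rw [indicator_of_mem hx, ← max_sub_sub_right, sub_self, sub_right_comm]
  have hcongr : ∀ m : Space N → ℝ,
      ∫ x in Ω, m x * (max (Metric.infDist x Ωᶜ - c) (Ω.indicator v x) - v x) =
        ∫ x in Ω, m x * max (Metric.infDist x Ωᶜ - v x - c) 0 := fun m =>
    setIntegral_congr_fun hΩ.measurableSet fun x hx => by simp only [hq x hx]
  have hvi' := hvi _ hmem
  rw [hcongr (fun _ => a), hcongr p, hcongr (fun x => inner ℝ b (G x)),
    integral_const_mul] at hvi'
  have htr1 : ∫ x in Ω, inner ℝ b (G x) * max (Metric.infDist x Ωᶜ - Ω.indicator v x - c) 0 =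
      ∫ x in Ω, inner ℝ b (G x) * max (Metric.infDist x Ωᶜ - v x - c) 0 :=
    setIntegral_congr_fun hΩ.measurableSet fun x hx => by simp only [indicator_of_mem hx]
  have htr2 : ∫ x in Ω, max (Metric.infDist x Ωᶜ - Ω.indicator v x - c) 0 =
      ∫ x in Ω, max (Metric.infDist x Ωᶜ - v x - c) 0 :=
    setIntegral_congr_fun hΩ.measurableSet fun x hx => by simp only [indicator_of_mem hx]
  rw [htr1, htr2] at htr
  have hnn : 0 ≤ ∫ x in Ω, max (Metric.infDist x Ωᶜ - v x - c) 0 :=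
    integral_nonneg fun x => le_max_right _ _
  nlinarith

/-- If the source exceeds `|b| + δ` on `[s, t]` with `δ (t - s) = 2D`, then the solution has
reached the distance function at time `t`. -/
lemma SolvesOn.eq_bdist (hΩ : IsOpen Ω) (hb : Bornology.IsBounded Ω)
    (hf : frontier Ω ⊆ closure (closure Ω)ᶜ) (hne : Ωᶜ.Nonempty) {K : Set (Space N → ℝ)}
    (hK : K = gradientSet Ω ∨ K = obstacleSet Ω) {b : Space N} {f : ℝ → ℝ} {z₀ : Space N → ℝ}
    {T : ℝ} {z : ℝ → Space N → ℝ} (hz : SolvesOn Ω b f z₀ K T z) {s t δ : ℝ}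
    (hs : s ∈ Ioo 0 T) (ht : t ∈ Ioo 0 T) (hst : s ≤ t)
    (hδ : δ * (t - s) = 2 * maxBdist Ω) (hδ0 : 0 ≤ δ) (hfs : ∀ τ, s ≤ τ → ‖b‖ + δ ≤ f τ) :
    ∀ x ∈ closure Ω, z t x = bdist Ω x := by
  obtain ⟨hzc, -, p, G, hp2, hzp, hG, hGH, hVI⟩ := hz
  have hT : 0 < T := hs.1.trans hs.2
  have : IsFiniteMeasure (volume.restrict Ω) := ⟨by
    rw [Measure.restrict_apply_univ]; exact hb.measure_lt_top⟩
  have : IsFiniteMeasure (volume.restrict (cylinder Ω T)) := by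
    rw [cylinder, restrict_prod_eq]; infer_instance
  have hp : IntegrableOn (fun q : ℝ × Space N => p q.1 q.2) (cylinder Ω T) :=
    hp2.integrable (by norm_num)
  have hpst : IntegrableOn (fun q : ℝ × Space N => p q.1 q.2) (Ioc s t ×ˢ Ω) :=
    hp.mono_set (prod_mono (fun r hr => ⟨hs.1.trans hr.1, hr.2.trans_lt ht.2⟩) subset_rfl)
  set d : Space N → ℝ := fun x => Metric.infDist x Ωᶜ with hd
  have hdc : Continuous d := Metric.continuous_infDist_pt _
  have hdD : ∀ x ∈ Ω, d x ≤ maxBdist Ω := fun x hx => by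
    have := bdist_le_maxBdist hb (subset_closure hx)
    rwa [bdist_eq_infDist_compl hΩ hne (subset_closure hx)] at this
  -- The value `2D` at time `s` puts `d - c` below `-d`; the slope `-δ` spends exactly the surplus
  -- of the source over `‖b‖` and brings `c` to zero at time `t`.
  set c : ℝ → ℝ := fun τ => 2 * maxBdist Ω - δ * (τ - s) with hcdef
  have hc0 : ∀ τ, τ ≤ t → 0 ≤ c τ := fun τ hτ => by
    have : δ * (τ - s) ≤ δ * (t - s) := by gcongr
    simp only [hcdef]
    linarith
  have hcs : c s = 2 * maxBdist Ω := by simp [hcdef]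
  have hct : c t = 0 := by simp [hcdef, hδ]
  obtain ⟨M, hM⟩ : ∃ M : ℝ≥0, ∀ᵐ q ∂volume.restrict (cylinder Ω T), ‖G q.1 q.2‖ ≤ M := by
    refine ⟨(eLpNorm (fun q : ℝ × Space N => G q.1 q.2) ⊤
      (volume.restrict (cylinder Ω T))).toNNReal, ?_⟩
    have hlt := hG.2
    filter_upwards [ae_le_eLpNormEssSup (f := fun q : ℝ × Space N => G q.1 q.2)
      (μ := volume.restrict (cylinder Ω T))] with q hq
    rw [← eLpNorm_exponent_top] at hq
    have := (ENNReal.toReal_le_toReal enorm_ne_top hlt.ne).2 hq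
    rwa [toReal_enorm] at this
  rw [cylinder, restrict_prod_eq] at hM
  have hslice : ∀ᵐ τ ∂volume.restrict (Ioo 0 T), (∀ x ∈ Ω, |z τ x| ≤ d x) ∧
      (τ ∈ Icc s t → δ * ∫ x in Ω, max (d x - z τ x - c τ) 0 ≤
        ∫ x in Ω, p τ x * max (d x - z τ x - c τ) 0) := by
    filter_upwards [hGH, hVI, Measure.ae_ae_of_ae_prod hM, ae_restrict_mem measurableSet_Ioo]
      with τ hGτ hVIτ hMτ hτ
    have hvc : ContinuousOn (z τ) Ω :=
      (continuousOn_slice hzc (Ioo_subset_Icc_self hτ)).mono subset_closure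
    have hvl := hGτ.lipschitzWith hΩ hb hf hvc hMτ
    obtain ⟨h1, h2⟩ := mem_convexSet_properties hΩ hb hf hne hK hvc hvl hVIτ.1
    exact ⟨h1, fun hst' => setIntegral_gap_le hΩ hb hGτ hvl (hfs τ hst'.1) (hc0 τ hst'.2)
      (h2 _ (hc0 τ hst'.2)) hVIτ.2⟩
  -- The constraint is given for almost every time only; continuity in time supplies it at the
  -- specific times `s` and `t`.
  have habs : ∀ τ ∈ Ioo 0 T, ∀ x ∈ Ω, |z τ x| ≤ d x := by
    intro τ hτ x hx
    refine le_of_ae_restrict_le (μ := volume) isOpen_Ioo (f := fun τ => |z τ x|)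
      (((continuousOn_path hzc (subset_closure hx)).mono Ioo_subset_Icc_self).abs)
      continuousOn_const ?_ τ hτ
    exact hslice.mono fun τ hτ => hτ.1 x hx
  set Q : ℝ → Space N → ℝ := fun τ x => max (d x - z τ x - c τ) 0 with hQ
  have hQc : ContinuousOn (fun q : ℝ × Space N => Q q.1 q.2) (Icc 0 T ×ˢ closure Ω) := by
    have h1 : Continuous fun q : ℝ × Space N => d q.2 := hdc.comp continuous_snd
    have h2 : Continuous fun q : ℝ × Space N => c q.1 := by fun_prop
    exact ContinuousOn.sup ((h1.continuousOn.sub hzc).sub h2.continuousOn) continuousOn_const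
  obtain ⟨B, hB⟩ := (isCompact_Icc.prod hb.isCompact_closure).exists_bound_of_continuousOn hQc
  have hsubst : Ioc s t ×ˢ Ω ⊆ Icc 0 T ×ˢ closure Ω :=
    prod_mono (fun r hr => ⟨(hs.1.trans hr.1).le, (hr.2.trans_lt ht.2).le⟩) subset_closure
  have hmst : MeasurableSet (Ioc s t ×ˢ Ω) := measurableSet_Ioc.prod hΩ.measurableSet
  have hint : Integrable (fun q : ℝ × Space N => 2 * Q q.1 q.2 * (δ - p q.1 q.2))
      ((volume.restrict (Ioc s t)).prod (volume.restrict Ω)) := by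
    rw [← restrict_prod_eq]
    have : IsFiniteMeasure ((volume : Measure (ℝ × Space N)).restrict (Ioc s t ×ˢ Ω)) := by
      rw [restrict_prod_eq]; infer_instance
    refine Integrable.bdd_mul (c := 2 * B) ((integrable_const δ).sub hpst) ?_ ?_
    · exact ((hQc.mono hsubst).aestronglyMeasurable hmst).const_mul 2
    · filter_upwards [ae_restrict_mem hmst] with q hq
      rw [norm_mul, Real.norm_ofNat]
      have := hB q (hsubst hq)
      gcongr
  -- Along almost every path the untruncated gap has derivative `δ - p`, and `Q` vanishes at time
  -- `s` because `d - z ≤ 2d ≤ 2D`.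
  have hchain : ∀ᵐ x ∂volume.restrict Ω,
      Q t x * Q t x = ∫ τ in Ioc s t, 2 * Q τ x * (δ - p τ x) := by
    filter_upwards [hzp.ae_forall_eq_add_integral hΩ hb hT hzc hp hs ht hst,
      ae_restrict_mem hΩ.measurableSet] with x hx hxΩ
    have hQs : Q s x = 0 := by
      have h1 := (abs_le.1 (habs s hs x hxΩ)).1
      have h2 := hdD x hxΩ
      exact max_eq_right (by rw [hcs]; linarith)
    have h3 := sq_max_sub_eq_integral (g := fun τ => d x - z τ x - c τ)
      (r := fun τ => δ - p τ x) hst (intervalIntegrable_const.sub hx.1) fun τ hτ => by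
        have hxτ : IntervalIntegrable (fun r => p r x) volume s τ := hx.1.mono_set (by
          rw [uIcc_of_le hst, uIcc_of_le hτ.1]
          exact Icc_subset_Icc_right hτ.2)
        rw [intervalIntegral.integral_sub intervalIntegrable_const hxτ, hx.2 τ hτ,
          intervalIntegral.integral_const, smul_eq_mul]
        simp only [hcdef]
        ring
    rw [intervalIntegral.integral_of_le hst] at h3
    have h4 : max (d x - z s x - c s) 0 = 0 := hQs
    rw [h4, mul_zero, sub_zero] at h3
    exact h3
  have hτle : ∀ᵐ τ ∂volume.restrict (Ioc s t), ∫ x in Ω, 2 * Q τ x * (δ - p τ x) ≤ 0 := by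
    rw [IntegrableOn, restrict_prod_eq] at hpst
    have hsl : ∀ᵐ τ ∂volume.restrict (Ioc s t), _ := ae_mono (Measure.restrict_mono
      (fun r (hr : r ∈ Ioc s t) => (⟨hs.1.trans hr.1, hr.2.trans_lt ht.2⟩ : r ∈ Ioo 0 T)) le_rfl)
      hslice
    filter_upwards [hsl, hpst.prod_right_ae, ae_restrict_mem measurableSet_Ioc] with τ h1 h2 hτ
    have hτI : τ ∈ Icc 0 T := ⟨(hs.1.trans hτ.1).le, (hτ.2.trans_lt ht.2).le⟩
    have h3 := h1.2 ⟨hτ.1.le, hτ.2⟩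
    have hQτ : ContinuousOn (Q τ) (closure Ω) := continuousOn_slice hQc hτI
    have hQi : IntegrableOn (Q τ) Ω :=
      (hQτ.integrableOn_compact hb.isCompact_closure).mono_set subset_closure
    have hpQ : IntegrableOn (fun x => p τ x * Q τ x) Ω := by
      refine Integrable.mul_bdd (c := B) h2
        ((hQτ.mono subset_closure).aestronglyMeasurable hΩ.measurableSet) ?_
      filter_upwards [ae_restrict_mem hΩ.measurableSet] with x hx
      exact hB (τ, x) ⟨hτI, subset_closure hx⟩
    have h4 : ∫ x in Ω, 2 * Q τ x * (δ - p τ x) =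
        2 * (δ * (∫ x in Ω, Q τ x) - ∫ x in Ω, p τ x * Q τ x) := by
      rw [← integral_const_mul, ← integral_sub (hQi.const_mul δ) hpQ, ← integral_const_mul]
      refine integral_congr_ae (Eventually.of_forall fun x => ?_)
      simp only
      ring
    rw [h4]
    linarith
  have hQt : ContinuousOn (Q t) (closure Ω) := continuousOn_slice hQc (Ioo_subset_Icc_self ht)
  -- Fubini turns the pathwise identity into a time integral of the slice inequalities in `hτle`.
  have hle : ∫ x in Ω, Q t x * Q t x ≤ 0 := by
    rw [integral_congr_ae hchain,
      integral_integral_swap (f := fun x τ => 2 * Q τ x * (δ - p τ x)) hint.swap]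
    exact integral_nonpos_of_ae hτle
  have hzero : ∀ᵐ x ∂volume.restrict Ω, Q t x * Q t x = 0 := by
    refine (integral_eq_zero_iff_of_nonneg (fun x => mul_self_nonneg _) ?_).1
      (le_antisymm hle (integral_nonneg fun x => mul_self_nonneg _))
    exact ((hQt.mul hQt).integrableOn_compact hb.isCompact_closure).mono_set subset_closure
  have hzt : ContinuousOn (z t) (closure Ω) := continuousOn_slice hzc (Ioo_subset_Icc_self ht)
  have hge : ∀ x ∈ Ω, d x ≤ z t x := by
    refine le_of_ae_restrict_le (μ := volume) hΩ hdc.continuousOn (hzt.mono subset_closure) ?_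
    filter_upwards [hzero] with x hx
    have h1 : max (d x - z t x - c t) 0 = 0 := mul_self_eq_zero.1 hx
    rw [hct, sub_zero] at h1
    exact sub_nonpos.1 ((le_max_left _ _).trans_eq h1)
  have heq : EqOn (z t) d (closure Ω) := by
    refine EqOn.of_subset_closure (s := Ω) (fun x hx => ?_) hzt hdc.continuousOn subset_closure
      subset_rfl
    exact le_antisymm (abs_le.1 (habs t ht x hx)).2 (hge x hx)
  intro x hx
  rw [bdist_eq_infDist_compl hΩ hne hx]
  exact heq hx

end Sandpile

/-! ### Choice of the uniform time. -/

theorem theorem4p3 (N : ℕ) (hN : 1 ≤ N)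
    (Ω : Set (Sandpile.Space N)) (hΩ_open : IsOpen Ω) (hΩ_bdd : Bornology.IsBounded Ω)
    (hΩ_C2 : Sandpile.HasC2Boundary Ω)
    (b : Sandpile.Space N)
    (f : ℝ → ℝ) (hf_bdd : ∀ T : ℝ, 0 < T → MemLp f ⊤ (volume.restrict (Set.Ioo 0 T)))
    (z₀ : Sandpile.Space N → ℝ) (hz₀ : z₀ ∈ Sandpile.gradientSet Ω)
    (Dz₀ : Sandpile.Space N → Sandpile.Space N) (hDz₀ : Sandpile.HasH10Gradient Ω z₀ Dz₀)
    (h_init : ∀ t : ℝ, 0 < t → ∀ᵐ x ∂volume.restrict Ω,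
      -Sandpile.bdist Ω x < z₀ x → inner ℝ b (Dz₀ x) ≤ f t)
    (hf_mono : MonotoneOn f (Set.Ioi 0)) (hf_nonneg : ∀ t : ℝ, 0 < t → 0 ≤ f t)
    (hf_liminf : ((‖b‖ + 2 * Sandpile.maxBdist Ω : ℝ) : EReal) <
      Filter.liminf (fun t : ℝ => ((f t : ℝ) : EReal)) Filter.atTop) :
    ∃ Tstar : ℝ, 0 ≤ Tstar ∧ ∀ z : ℝ → Sandpile.Space N → ℝ,
      (Sandpile.Solves Ω b f z₀ (Sandpile.gradientSet Ω) z ∨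
        Sandpile.Solves Ω b f z₀ (Sandpile.obstacleSet Ω) z) →
      ∀ t : ℝ, Tstar ≤ t → ∀ x ∈ closure Ω, z t x = Sandpile.bdist Ω x := by
  have hD : 0 ≤ Sandpile.maxBdist Ω := Sandpile.maxBdist_nonneg
  -- A real number in between keeps the surplus `δ = r - ‖b‖` finite even when the lower limit is
  -- `+∞`.
  obtain ⟨r, hr1, hr2⟩ := EReal.lt_iff_exists_real_btwn.1 hf_liminf
  have hr1' : ‖b‖ + 2 * Sandpile.maxBdist Ω < r := EReal.coe_lt_coe_iff.1 hr1
  obtain ⟨T₀, hT₀⟩ := eventually_atTop.1 (eventually_lt_of_lt_liminf hr2)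
  set δ := r - ‖b‖ with hδ
  have hδ0 : 0 < δ := by linarith
  have hstep : 0 ≤ 2 * Sandpile.maxBdist Ω / δ := by positivity
  -- The barrier needs time `2D/δ` to climb; it starts after `T₀`, when `f > r`, and after time `1`,
  -- which keeps the starting time positive. Nothing here depends on `z`.
  refine ⟨max T₀ 1 + 2 * Sandpile.maxBdist Ω / δ, by positivity, fun z hz t ht => ?_⟩
  have hs0 : max T₀ 1 ≤ t - 2 * Sandpile.maxBdist Ω / δ := by linarith
  have hs1 : 0 < t - 2 * Sandpile.maxBdist Ω / δ :=
    zero_lt_one.trans_le ((le_max_right _ _).trans hs0)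
  obtain ⟨K, hK, hzK⟩ : ∃ K, (K = Sandpile.gradientSet Ω ∨ K = Sandpile.obstacleSet Ω) ∧
      Sandpile.Solves Ω b f z₀ K z := by
    rcases hz with h | h
    exacts [⟨_, Or.inl rfl, h⟩, ⟨_, Or.inr rfl, h⟩]
  -- The horizon `t + 1` makes `t` an interior time.
  refine (hzK (t + 1) (by linarith)).eq_bdist hΩ_open hΩ_bdd
    (hΩ_C2.frontier_subset_closure hΩ_open) (Sandpile.compl_nonempty_of_isBounded hN hΩ_bdd) hK
    (s := t - 2 * Sandpile.maxBdist Ω / δ) (δ := δ) ⟨hs1, by linarith⟩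
    ⟨by linarith, by linarith⟩ (by linarith) ?_ hδ0.le fun τ hτ => ?_
  · rw [sub_sub_cancel, mul_div_cancel₀ _ hδ0.ne']
  · have h1 := EReal.coe_lt_coe_iff.1 (hT₀ τ ((le_max_left _ _).trans (hs0.trans hτ)))
    rw [hδ]
    linarith
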